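/- Let $\hat M$ be a complete connected smooth Riemannian manifold of dimension $n$ with Riemannian distance $d$, let $M\subset\hat M$ be compact, and let $m$ be a Borel probability measure on $\hat M$ with support $M$ that is absolutely continuous with respect to the Riemannian volume measure. For $u:M\to\mathbb{R}$ put $$u^{\mathfrak c}(x)=-\inf_{y\in M}\Big[\tfrac12 d^2(x,y)+u(y)\Big],\qquad x\in M,$$ and let $\mathcal K$ be the set of $d^2/2$-convex functions on $M$, that is, of the functions $\varphi:M\to\mathbb{R}$ such that $\varphi=\psi^{\mathfrak c}$ for some $\psi:M\to\mathbb{R}$ (the infimum being finite for all $x\in M$). For a function $u$ on $M$ that is differentiable (along $M$) $m$-almost everywhere, with gradient $\nabla u$, let $$\|u\|_{H^1}=\Big[\int_M|\nabla u|^2\,dm+\int_M u^2\,dm\Big]^{1/2}.$$ Then every $\varphi\in\mathcal K$ is Lipschitz continuous and differentiable $m$-almost everywhere, $|\nabla\varphi|$ is measurable, and $\|\varphi\|_{H^1}<\infty$; moreover $\varphi\in\mathcal K$ implies $\varphi^{\mathfrak c}\in\mathcal K$, and the conjugation map $$\mathfrak C_{\mathcal K}:\mathcal K\to\mathcal K,\qquad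 \varphi\mapsto\varphi^{\mathfrak c},$$ is continuous with respect to the $H^1$-norm: for every $\varphi\in\mathcal K$ and $\varepsilon>0$ there is $\delta>0$ such that $\|\psi^{\mathfrak c}-\varphi^{\mathfrak c}\|_{H^1}<\varepsilon$ for all $\psi\in\mathcal K$ with $\|\psi-\varphi\|_{H^1}<\delta$. -/

import Mathlib

open MeasureTheory Bundle
open scoped Manifold ContDiff ENNReal Bundle

noncomputable section

namespace ConjugationMap

section Convexity

variable {N : Type*} [MetricSpace N]

/-- The generalized Legendre transform `u^c(x) = -inf_{y ∈ M} [d(x,y)²/2 + u(y)]` of a function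
on the subset `M`, with respect to the distance of the ambient space. -/
def conj (M : Set N) (u : M → ℝ) : M → ℝ :=
  fun x ↦ -⨅ y : M, ((dist (x : N) (y : N)) ^ 2 / 2 + u y)

/-- The set `𝒦(M)` of `d²/2`-convex functions `φ : M → ℝ`: there is `ψ : M → ℝ` such that, for
every `x ∈ M`, the infimum of `d(x,y)²/2 + ψ(y)` over `y ∈ M` is finite and equal to `-φ(x)`. -/
def convexFunctions (M : Set N) : Set (M → ℝ) :=
  {φ | ∃ ψ : M → ℝ, ∀ x : M,
    IsGLB (Set.range fun y : M ↦ (dist (x : N) (y : N)) ^ 2 / 2 + ψ y) (-φ x)}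

end Convexity

section Riemannian

variable {n : ℕ} {N : Type*} [MetricSpace N] [ChartedSpace (EuclideanSpace ℝ (Fin n)) N]
  [RiemannianBundle (fun x : N ↦ TangentSpace (𝓡 n) x)]

/-- The matrix `g_{ij}` of the Riemannian metric in the chart `e`, at the point with coordinates
`y`: the inner products of the coordinate vector fields. -/
def metricMatrix (e : OpenPartialHomeomorph N (EuclideanSpace ℝ (Fin n)))
    (y : EuclideanSpace ℝ (Fin n)) : Matrix (Fin n) (Fin n) ℝ :=
  let v : Fin n → TangentSpace (𝓡 n) (e.symm y) := fun i ↦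
    mfderiv (𝓡 n) (𝓡 n) e.symm y (EuclideanSpace.single i (1 : ℝ) : EuclideanSpace ℝ (Fin n))
  Matrix.of fun i j ↦ inner ℝ (v i) (v j)

/-- The Riemannian volume of the domain of the chart `e`, that is `√(det g) dy` carried from the
target of `e` to the manifold; it gives no mass to the complement of the domain. -/
def chartVolume [MeasurableSpace N] (e : OpenPartialHomeomorph N (EuclideanSpace ℝ (Fin n))) :
    Measure N :=
  Measure.map e.symm (((volume : Measure (EuclideanSpace ℝ (Fin n))).restrict e.target).withDensity
    fun y ↦ ENNReal.ofReal (√(metricMatrix e y).det))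

variable (n N) in
/-- The Riemannian volume measure: the smallest measure that dominates `√(det g) dy` on the domain
of every chart of the atlas. As these measures agree on overlaps, it restricts to `√(det g) dy` on
each of these domains. -/
def riemannianVolume [MeasurableSpace N] : Measure N :=
  ⨆ e ∈ atlas (EuclideanSpace ℝ (Fin n)) N, chartVolume e

/-- The extension by zero of a function on `M`. Only its values on `M` will matter. -/
def extendZero (M : Set N) (u : M → ℝ) : N → ℝ :=
  Function.extend Subtype.val u 0

variable (n) in
/-- `v` is a gradient at the point `x` of the function `u` on `M`: `u` is differentiable at `x`
along `M`, with differential `⟨v, ·⟩`. -/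
def HasGradAt (M : Set N) (u : M → ℝ) (x : N) (v : TangentSpace (𝓡 n) x) : Prop :=
  HasMFDerivWithinAt (𝓡 n) 𝓘(ℝ, ℝ) (extendZero M u) M x (innerSL ℝ v)

open Classical in
variable (n) in
/-- The gradient `∇u` of a function on `M`, set to zero where `u` is not differentiable. At the
points of density of `M`, the gradient is unique if it exists. -/
def grad (M : Set N) (u : M → ℝ) (x : N) : TangentSpace (𝓡 n) x :=
  if h : ∃ v, HasGradAt n M u x v then h.choose else 0

variable (n) in
/-- The norm `‖u‖_{H¹} = (∫_M |∇u|² dm + ∫_M u² dm)^{1/2}`. -/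
def h1Norm [MeasurableSpace N] (m : Measure N) (M : Set N) (u : M → ℝ) : ℝ≥0∞ :=
  ((∫⁻ x in M, ‖grad n M u x‖ₑ ^ 2 ∂m) + ∫⁻ x in M, ‖extendZero M u x‖ₑ ^ 2 ∂m) ^ (1 / 2 : ℝ)

variable (n) in
/-- `u` is a Lipschitz function on `M` that lies in `H¹(M, m)`: it is differentiable at `m`-almost
every point, the length of its gradient is measurable, and its `H¹` norm is finite. -/
structure IsLipschitzH1 [MeasurableSpace N] (m : Measure N) (M : Set N) (u : M → ℝ) : Prop where
  lipschitz : ∃ C, LipschitzWith C u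
  ae_differentiable : ∀ᵐ x ∂m.restrict M, ∃ v, HasGradAt n M u x v
  aemeasurable : AEMeasurable (fun x ↦ ‖grad n M u x‖ₑ) (m.restrict M)
  h1Norm_lt_top : h1Norm n m M u < ⊤

end Riemannian

end ConjugationMap

end

/-! In a chart, the functions `d²(·, y)/2` are semiconcave, uniformly in `y ∈ M`, with modulus
`|k| ^ (4/3)`: the metric is Lipschitz in the chart, so that `d` agrees at small scale `ρ` with a
parallelogram norm up to an error of order `ρ ^ 2`, and almost-minimizing intermediate points allow
to replace the endpoint `y` by a point at such a scale. All conjugates `u^c` are therefore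
semiconvex with one and the same modulus. If `ψ_i → φ` in `H¹` with `ψ_i, φ ∈ 𝒦`, the convergence
is uniform, because these functions are equi-Lipschitz and `m` charges every ball centred in `M`;
hence `ψ_i^c → φ^c` uniformly. For uniformly semiconvex functions, uniform convergence implies
convergence of the differentials wherever these exist, that is `m`-almost everywhere by Rademacher's
theorem, and the gradients are bounded by a common Lipschitz constant, so that dominated convergence
concludes. The length of a gradient is measurable as a limit of slopes over small balls. -/

noncomputable section

namespace ConjugationMap

open Set Filter Metric Manifold
open scoped Topology NNReal

section Semiconcave

variable {E : Type*} [NormedAddCommGroup E] {s : Set E} {p C : ℝ}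

/-- Semiconcavity of `f` on `s` with modulus `C‖k‖ᵖ`, as a bound on second differences. For `p = 2`
this is the usual semiconcavity with linear modulus. -/
def SemiconcaveOn (s : Set E) (p C : ℝ) (f : E → ℝ) : Prop :=
  ∀ b k, b ∈ s → b + k ∈ s → b - k ∈ s → f (b + k) + f (b - k) - 2 * f b ≤ C * ‖k‖ ^ p

lemma SemiconcaveOn.ciInf {ι : Type*} [Nonempty ι] {f : ι → E → ℝ}
    (hbdd : ∀ x ∈ s, BddBelow (range fun i ↦ f i x)) (hf : ∀ i, SemiconcaveOn s p C (f i)) :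
    SemiconcaveOn s p C fun x ↦ ⨅ i, f i x := by
  intro b k hb hadd hsub
  have hmid : ((⨅ i, f i (b + k)) + (⨅ i, f i (b - k)) - C * ‖k‖ ^ p) / 2 ≤ ⨅ i, f i b :=
    le_ciInf fun i ↦ by
      linarith [hf i b k hb hadd hsub, ciInf_le (hbdd _ hadd) i, ciInf_le (hbdd _ hsub) i]
  linarith

lemma isLittleO_norm_rpow_id (hp : 1 < p) :
    (fun h : E ↦ ‖h‖ ^ p) =o[𝓝 0] fun h ↦ h := by
  have hlim : Tendsto (fun h : E ↦ ‖h‖ ^ (p - 1)) (𝓝 0) (𝓝 0) := by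
    have hp' : p - 1 ≠ 0 := (sub_pos.2 hp).ne'
    simpa [Real.zero_rpow hp'] using tendsto_norm_zero.rpow_const (Or.inr (sub_pos.2 hp).le)
  have hmul := ((Asymptotics.isLittleO_one_iff ℝ).2 hlim).mul_isBigO
    (Asymptotics.isBigO_refl (fun h : E ↦ ‖h‖) _)
  refine (hmul.congr (fun h ↦ ?_) fun h ↦ one_mul _).of_norm_right
  rw [← Real.rpow_add_one' (norm_nonneg h) (by linarith), sub_add_cancel]

variable [NormedSpace ℝ E]

lemma SemiconcaveOn.two_pow_mul_sub_le {f : E → ℝ} {a h : E} {r : ℝ}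
    (hf : SemiconcaveOn (ball a r) p C f) (hh : ‖h‖ < r) (j : ℕ) :
    2 ^ j * (f (a + (2 ^ j : ℝ)⁻¹ • h) - f a) ≤
      2 ^ (j + 1) * (f (a + (2 ^ (j + 1) : ℝ)⁻¹ • h) - f a) +
        2 ^ j * (C * (((2 ^ p)⁻¹) ^ (j + 1) * ‖h‖ ^ p)) := by
  have hmem : ∀ i : ℕ, a + (2 ^ i : ℝ)⁻¹ • h ∈ ball a r := fun i ↦ by
    rw [mem_ball_iff_norm, add_sub_cancel_left, norm_smul, Real.norm_of_nonneg (by positivity)]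
    exact (mul_le_of_le_one_left (norm_nonneg h)
      (inv_le_one_of_one_le₀ (one_le_pow₀ one_le_two))).trans_lt hh
  set k := (2 ^ (j + 1) : ℝ)⁻¹ • h with hk
  have hadd : a + k + k = a + (2 ^ j : ℝ)⁻¹ • h := by
    rw [hk, pow_succ, mul_inv]
    module
  have hnorm : ‖k‖ ^ p = ((2 ^ p)⁻¹) ^ (j + 1) * ‖h‖ ^ p := by
    rw [hk, norm_smul, Real.mul_rpow (norm_nonneg _) (norm_nonneg _),
      Real.norm_of_nonneg (by positivity), Real.inv_rpow (by positivity), inv_pow,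
      ← Real.rpow_natCast_mul zero_le_two, mul_comm _ p, Real.rpow_mul_natCast zero_le_two]
  have hdiff := hf (a + k) k (hmem _) (hadd ▸ hmem j)
    (by simpa using mem_ball_self (x := a) ((norm_nonneg h).trans_lt hh))
  rw [hadd, add_sub_cancel_right, hnorm] at hdiff
  have hscaled := mul_le_mul_of_nonneg_left hdiff (pow_nonneg zero_le_two j : (0 : ℝ) ≤ 2 ^ j)
  rw [pow_succ 2 j]
  linarith

lemma SemiconcaveOn.sub_le_of_hasFDerivAt {f : E → ℝ} {f' : E →L[ℝ] ℝ} {a h : E} {r : ℝ}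
    (hf : SemiconcaveOn (ball a r) p C f) (hp : 1 < p) (hd : HasFDerivAt f f' a) (hh : ‖h‖ < r) :
    f (a + h) - f a ≤ f' h + C / (2 ^ p - 2) * ‖h‖ ^ p := by
  have hp2 : (2 : ℝ) < 2 ^ p := by
    simpa using Real.rpow_lt_rpow_of_exponent_lt one_lt_two hp
  set A := C / (2 ^ p - 2) * ‖h‖ ^ p with hA
  -- The dyadic difference quotients, corrected by a geometric sequence, increase to `f' h`.
  let u : ℕ → ℝ := fun j ↦
    2 ^ j * (f (a + (2 ^ j : ℝ)⁻¹ • h) - f a) - A * (2 / 2 ^ p) ^ j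
  have hmono : Monotone u := monotone_nat_of_le_succ fun j ↦ by
    have hgeom : 2 ^ j * (C * (((2 ^ p)⁻¹) ^ (j + 1) * ‖h‖ ^ p)) =
        A * (2 / 2 ^ p) ^ j - A * (2 / 2 ^ p) ^ (j + 1) := by
      have : (2 : ℝ) ^ p - 2 ≠ 0 := by linarith
      simp only [hA, div_pow, inv_pow, pow_succ]
      field_simp
    linarith [hf.two_pow_mul_sub_le hh j]
  have hlim : Tendsto u atTop (𝓝 (f' h)) := by
    have hquot := (hd.lim_real h).comp (tendsto_pow_atTop_atTop_of_one_lt one_lt_two)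
    have hq : Tendsto (fun j : ℕ ↦ A * (2 / 2 ^ p : ℝ) ^ j) atTop (𝓝 (A * 0)) :=
      (tendsto_pow_atTop_nhds_zero_of_lt_one (by positivity)
        ((div_lt_one (by positivity)).2 hp2)).const_mul A
    simpa using hquot.sub hq
  have hfirst := hmono.ge_of_tendsto hlim 0
  simp only [u, pow_zero, one_mul, inv_one, one_smul, mul_one] at hfirst
  linarith

lemma tendsto_fderiv_of_semiconcaveOn {ι : Type*} {l : Filter ι} {f : ι → E → ℝ} {g : E → ℝ}
    {f' : ι → E →L[ℝ] ℝ} {g' : E →L[ℝ] ℝ} {a : E} {r : ℝ} (hr : 0 < r) (hp : 1 < p)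
    (hf : ∀ i, SemiconcaveOn (ball a r) p C (f i)) (hlim : TendstoUniformlyOn f g l (ball a r))
    (hf' : ∀ i, HasFDerivAt (f i) (f' i) a) (hg' : HasFDerivAt g g' a) :
    Tendsto f' l (𝓝 g') := by
  rw [Metric.tendsto_nhds]
  intro ε hε
  have hsmall : ∀ᶠ h : E in 𝓝 0,
      C / (2 ^ p - 2) * ‖h‖ ^ p - (g (a + h) - g a - g' h) ≤ ε / 4 * ‖h‖ :=
    ((((isLittleO_norm_rpow_id hp).const_mul_left _).sub
      (hasFDerivAt_iff_isLittleO_nhds_zero.1 hg')).bound (by positivity)).mono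
      fun h hh ↦ (le_abs_self _).trans hh
  obtain ⟨δ', hδ', hball⟩ := Metric.eventually_nhds_iff_ball.1 hsmall
  obtain ⟨δ, hδ, hδlt⟩ := exists_between (lt_min hr hδ')
  filter_upwards [Metric.tendstoUniformlyOn_iff.1 hlim (ε / 8 * δ) (by positivity)] with i hi
  have hle : ∀ h, ‖h‖ ≤ δ → (g' - f' i) h ≤ ε / 2 * δ := fun h hh ↦ by
    have hhr : ‖h‖ < r := hh.trans_lt (hδlt.trans_le (min_le_left _ _))
    have hsemi := (hf i).sub_le_of_hasFDerivAt hp (hf' i) hhr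
    have hrem := hball h (mem_ball_zero_iff.2 (hh.trans_lt (hδlt.trans_le (min_le_right _ _))))
    have hnear := abs_lt.1 (hi (a + h) (by simpa using hhr))
    have hcentre := abs_lt.1 (hi a (mem_ball_self hr))
    have hnorm : ε / 4 * ‖h‖ ≤ ε / 4 * δ := by gcongr
    rw [sub_apply]
    linarith
  rw [dist_comm, dist_eq_norm]
  calc ‖g' - f' i‖ ≤ ε / 2 * δ / δ :=
        ContinuousLinearMap.opNorm_bound_of_ball_bound hδ _ _ fun h hh ↦ by
          rw [mem_closedBall_zero_iff] at hh
          refine abs_le'.2 ⟨hle h hh, ?_⟩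
          simpa only [map_neg] using hle (-h) (by rwa [norm_neg])
    _ < ε := by rw [mul_div_cancel_right₀ _ hδ.ne']; linarith

end Semiconcave

section SquaredDistance

variable {N : Type*} [PseudoMetricSpace N]

variable (N) in
/-- Every two points have almost intermediate points in every ratio: a form of being a length
space that does not mention curves. -/
def HasAlmostIntermediatePoints : Prop :=
  ∀ (x y : N), ∀ τ ∈ Icc (0 : ℝ) 1, ∀ η > 0,
    ∃ z, dist x z = τ * dist x y ∧ dist z y ≤ (1 - τ) * dist x y + η

lemma HasAlmostIntermediatePoints.exists_sq_dist_le (hN : HasAlmostIntermediatePoints N) (x y : N)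
    {τ η : ℝ} (hτ : τ ∈ Ioo (0 : ℝ) 1) (hη : 0 < η) :
    ∃ z, dist x z = τ * dist x y ∧
      ∀ w, dist w y ^ 2 ≤ dist w z ^ 2 / τ + (1 - τ) * dist x y ^ 2 + η := by
  have hτ' : 0 < 1 - τ := sub_pos.2 hτ.2
  obtain ⟨δ, hδη, hδ⟩ : ∃ δ, ((1 - τ) * dist x y + δ) ^ 2 / (1 - τ) <
      (1 - τ) * dist x y ^ 2 + η ∧ 0 < δ := by
    have hcont : ContinuousAt (fun δ ↦ ((1 - τ) * dist x y + δ) ^ 2 / (1 - τ)) 0 := by fun_prop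
    have h0 : ((1 - τ) * dist x y + 0) ^ 2 / (1 - τ) < (1 - τ) * dist x y ^ 2 + η := by
      rw [add_zero, mul_pow, sq (1 - τ), mul_assoc, mul_div_cancel_left₀ _ hτ'.ne']
      exact lt_add_of_pos_right _ hη
    exact (((hcont.eventually_lt_const h0).filter_mono nhdsWithin_le_nhds).and
      (self_mem_nhdsWithin : Ioi (0 : ℝ) ∈ 𝓝[>] 0)).exists
  obtain ⟨z, hxz, hzy⟩ := hN x y τ (Ioo_subset_Icc_self hτ) δ hδ
  refine ⟨z, hxz, fun w ↦ ?_⟩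
  calc dist w y ^ 2 ≤ (dist w z + dist z y) ^ 2 := by gcongr; exact dist_triangle _ _ _
    _ ≤ dist w z ^ 2 / τ + dist z y ^ 2 / (1 - τ) := by
        simpa using Finset.sq_sum_div_le_sum_sq_div Finset.univ ![dist w z, dist z y]
          (g := ![τ, 1 - τ]) (by simp [Fin.forall_fin_two, hτ.1, hτ.2])
    _ ≤ dist w z ^ 2 / τ + ((1 - τ) * dist x y + δ) ^ 2 / (1 - τ) := by gcongr
    _ ≤ dist w z ^ 2 / τ + (1 - τ) * dist x y ^ 2 + η := by linarith

variable {E : Type*} [NormedAddCommGroup E] [NormedSpace ℝ E]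

/-- `P` parametrizes a neighbourhood of `P c` by the ball `ball c R`, and near each `a` in this ball
it is, up to a relative error of the order of the distance to `a`, an isometry for the seminorm
`p a`. The seminorms satisfy the parallelogram law, and `K` bounds all distortions. The inverse
charts of a Riemannian manifold have this property. -/
structure IsAlmostIsometric (P : E → N) (p : E → Seminorm ℝ E) (c : E) (R K : ℝ) : Prop where
  radius_pos : 0 < R
  one_le : 1 ≤ K
  mul_radius_le_one : K * R ≤ 1
  exists_ball_subset : ∃ σ > 0, ball (P c) σ ⊆ P '' ball c R
  parallelogram : ∀ a u v, p a (u - v) ^ 2 + p a (u + v) ^ 2 = 2 * p a u ^ 2 + 2 * p a v ^ 2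
  le_mul_norm : ∀ a ∈ ball c R, ∀ w, p a w ≤ K * ‖w‖
  norm_le_mul : ∀ a ∈ ball c R, ∀ w, ‖w‖ ≤ K * p a w
  dist_le : ∀ ⦃a z z' ρ⦄, a ∈ ball c R → z ∈ ball c R → z' ∈ ball c R → ‖z - a‖ ≤ ρ →
    ‖z' - a‖ ≤ ρ → dist (P z) (P z') ≤ (1 + K * ρ) * p a (z' - z)
  le_dist : ∀ ⦃a z z' ρ⦄, a ∈ ball c R → z ∈ ball c R → z' ∈ ball c R → ‖z - a‖ ≤ ρ →
    ‖z' - a‖ ≤ ρ → p a (z' - z) ≤ (1 + K * ρ) * dist (P z) (P z')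

namespace IsAlmostIsometric

variable {P : E → N} {p : E → Seminorm ℝ E} {c : E} {R K : ℝ} (h : IsAlmostIsometric P p c R K)
include h

lemma mul_norm_sub_le {z z' : E} (hz : z ∈ ball c R) (hz' : z' ∈ ball c R) :
    K * ‖z' - z‖ ≤ 2 := by
  have hK := h.one_le
  have hlt : ‖z' - z‖ < R + R := by
    rw [← dist_eq_norm]
    exact (dist_triangle_right z' z c).trans_lt (add_lt_add hz' hz)
  nlinarith [h.mul_radius_le_one]

lemma dist_le_mul_norm {z z' : E} (hz : z ∈ ball c R) (hz' : z' ∈ ball c R) :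
    dist (P z) (P z') ≤ 3 * K * ‖z' - z‖ := by
  have := h.one_le
  calc dist (P z) (P z') ≤ (1 + K * ‖z' - z‖) * p z (z' - z) :=
        h.dist_le hz hz hz' (by simp) le_rfl
    _ ≤ 3 * (K * ‖z' - z‖) := by
        gcongr
        · linarith [h.mul_norm_sub_le hz hz']
        · exact h.le_mul_norm z hz _
    _ = 3 * K * ‖z' - z‖ := by ring

lemma norm_sub_le_mul_dist {z z' : E} (hz : z ∈ ball c R) (hz' : z' ∈ ball c R) :
    ‖z' - z‖ ≤ 3 * K * dist (P z) (P z') := by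
  have hK := h.one_le
  calc ‖z' - z‖ ≤ K * p z (z' - z) := h.norm_le_mul z hz _
    _ ≤ K * ((1 + K * ‖z' - z‖) * dist (P z) (P z')) := by
        gcongr
        exact h.le_dist hz hz hz' (by simp) le_rfl
    _ ≤ K * (3 * dist (P z) (P z')) := by
        gcongr
        linarith [h.mul_norm_sub_le hz hz']
    _ = 3 * K * dist (P z) (P z') := by ring

lemma sq_dist_add_sq_dist_le {a k ζ : E} {ρ : ℝ} (ha : a ∈ ball c R) (hadd : a + k ∈ ball c R)
    (hsub : a - k ∈ ball c R) (hζ : ζ ∈ ball c R) (hk : ‖k‖ ≤ ρ) (hζa : ‖ζ - a‖ ≤ ρ)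
    (hρ : K * ρ ≤ 1) :
    dist (P (a + k)) (P ζ) ^ 2 + dist (P (a - k)) (P ζ) ^ 2 ≤
      (2 + 30 * (K * ρ)) * dist (P a) (P ζ) ^ 2 + 8 * K ^ 2 * ‖k‖ ^ 2 := by
  have hK := h.one_le
  have hρ0 : 0 ≤ ρ := (norm_nonneg k).trans hk
  set t := K * ρ
  have ht0 : 0 ≤ t := by positivity
  have hpow : (1 + t) ^ 4 ≤ 1 + 15 * t := by
    have hsq : t ^ 2 ≤ t := by nlinarith
    have hcube : t ^ 3 ≤ t := by nlinarith
    nlinarith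
  calc dist (P (a + k)) (P ζ) ^ 2 + dist (P (a - k)) (P ζ) ^ 2
      ≤ ((1 + t) * p a (ζ - (a + k))) ^ 2 + ((1 + t) * p a (ζ - (a - k))) ^ 2 := by
        gcongr
        · exact h.dist_le ha hadd hζ (by simpa using hk) hζa
        · exact h.dist_le ha hsub hζ (by simpa using hk) hζa
    _ = (1 + t) ^ 2 * (2 * p a (ζ - a) ^ 2 + 2 * p a k ^ 2) := by
        rw [← h.parallelogram a (ζ - a) k, sub_sub, sub_add]
        ring
    _ ≤ (1 + t) ^ 2 * (2 * ((1 + t) * dist (P a) (P ζ)) ^ 2 + 2 * (K * ‖k‖) ^ 2) := by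
        gcongr
        · exact h.le_dist ha ha hζ (by simpa using hρ0) hζa
        · exact h.le_mul_norm a ha k
    _ = (1 + t) ^ 4 * (2 * dist (P a) (P ζ) ^ 2) + (1 + t) ^ 2 * (2 * K ^ 2 * ‖k‖ ^ 2) := by ring
    _ ≤ (1 + 15 * t) * (2 * dist (P a) (P ζ) ^ 2) + (1 + 1) ^ 2 * (2 * K ^ 2 * ‖k‖ ^ 2) := by gcongr
    _ = _ := by ring

lemma secondDiff_sq_dist_le (hN : HasAlmostIntermediatePoints N) {b k : E} {y : N} {σ τ D : ℝ}
    (hσ : ball (P c) σ ⊆ P '' ball c R) (hb : b ∈ ball c R) (hadd : b + k ∈ ball c R)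
    (hsub : b - k ∈ ball c R) (hbσ : dist (P b) (P c) + τ * D < σ) (hD : dist (P b) y ≤ D)
    (hτ : τ ∈ Ioo (0 : ℝ) 1) (hk : ‖k‖ ≤ τ) (hKτ : K * (3 * K * D + 1) * τ ≤ 1) :
    dist (P (b + k)) y ^ 2 + dist (P (b - k)) y ^ 2 - 2 * dist (P b) y ^ 2 ≤
      (30 * (K * (3 * K * D + 1)) * D ^ 2) * τ ^ 2 + 8 * K ^ 2 * (‖k‖ ^ 2 / τ) := by
  have hK := h.one_le
  have hD0 : 0 ≤ D := dist_nonneg.trans hD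
  refine le_of_forall_pos_le_add fun η hη ↦ ?_
  obtain ⟨z, hbz, hz⟩ := hN.exists_sq_dist_le (P b) y hτ (half_pos hη)
  have hbzD : dist (P b) z ≤ τ * D := hbz ▸ mul_le_mul_of_nonneg_left hD hτ.1.le
  obtain ⟨ζ, hζ, rfl⟩ : z ∈ P '' ball c R := hσ <| by
    rw [mem_ball]
    linarith [dist_triangle_left z (P c) (P b)]
  have hζb : ‖ζ - b‖ ≤ (3 * K * D + 1) * τ :=
    calc ‖ζ - b‖ ≤ 3 * K * dist (P b) (P ζ) := h.norm_sub_le_mul_dist hb hζ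
      _ ≤ 3 * K * (τ * D) := by gcongr
      _ ≤ (3 * K * D + 1) * τ := by linarith [hτ.1]
  have hkρ : ‖k‖ ≤ (3 * K * D + 1) * τ :=
    hk.trans (le_mul_of_one_le_left hτ.1.le (le_add_of_nonneg_left (by positivity)))
  have hnear := h.sq_dist_add_sq_dist_le hb hadd hsub hζ hkρ hζb (by linarith)
  have hscaled : (dist (P (b + k)) (P ζ) ^ 2 + dist (P (b - k)) (P ζ) ^ 2) / τ ≤
      2 * τ * dist (P b) y ^ 2 + 30 * (K * (3 * K * D + 1)) * D ^ 2 * τ ^ 2 +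
        8 * K ^ 2 * (‖k‖ ^ 2 / τ) := by
    rw [div_le_iff₀ hτ.1]
    calc _ ≤ _ := hnear
      _ = 2 * (τ * dist (P b) y) ^ 2 + 30 * (K * (3 * K * D + 1) * τ) * dist (P b) (P ζ) ^ 2 +
          8 * K ^ 2 * ‖k‖ ^ 2 := by rw [hbz]; ring
      _ ≤ 2 * (τ * dist (P b) y) ^ 2 + 30 * (K * (3 * K * D + 1) * τ) * (τ * D) ^ 2 +
          8 * K ^ 2 * ‖k‖ ^ 2 := by
        have := hτ.1
        gcongr
      _ = _ := by
        have := hτ.1.ne'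
        field_simp
  rw [add_div] at hscaled
  linarith [hz (P (b + k)), hz (P (b - k))]

lemma semiconcaveOn_sq_dist (hN : HasAlmostIntermediatePoints N) {r σ D : ℝ} {y : N}
    (hσ : ball (P c) σ ⊆ P '' ball c R) (hrR : r ≤ R) (hr : r < 1)
    (hrσ : 3 * K * r + r ^ (2 / 3 : ℝ) * D ≤ σ)
    (hrD : K * (3 * K * D + 1) * r ^ (2 / 3 : ℝ) ≤ 1) (hy : ∀ b ∈ ball c r, dist (P b) y ≤ D) :
    SemiconcaveOn (ball c r) (4 / 3) (30 * (K * (3 * K * D + 1)) * D ^ 2 + 8 * K ^ 2)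
      fun z ↦ dist (P z) y ^ 2 := by
  intro b k hb hadd hsub
  have hK := h.one_le
  have hD : 0 ≤ D := dist_nonneg.trans (hy b hb)
  have hball := ball_subset_ball (x := c) hrR
  obtain rfl | hk := eq_or_ne k 0
  · simp [Real.zero_rpow, two_mul]
  have hk0 : 0 < ‖k‖ := norm_pos_iff.2 hk
  have hkr : ‖k‖ < r := by
    have h2k : ‖(2 : ℝ) • k‖ < r + r :=
      calc ‖(2 : ℝ) • k‖ = dist (b + k) (b - k) := by rw [dist_eq_norm]; congr 1; module
        _ < r + r := (dist_triangle_right _ _ c).trans_lt (add_lt_add hadd hsub)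
    rw [norm_smul, Real.norm_two] at h2k
    linarith
  have hbc : dist (P b) (P c) < 3 * K * r :=
    calc dist (P b) (P c) ≤ 3 * K * ‖c - b‖ :=
          h.dist_le_mul_norm (hball hb) (mem_ball_self h.radius_pos)
      _ < 3 * K * r := by gcongr; exact mem_ball_iff_norm'.1 hb
  -- `τ = ‖k‖^(2/3)` balances the two error terms `τ²` and `‖k‖²/τ`.
  set τ := ‖k‖ ^ (2 / 3 : ℝ) with hτ
  have hτr : τ ≤ r ^ (2 / 3 : ℝ) := Real.rpow_le_rpow hk0.le hkr.le (by norm_num)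
  have hτ1 : τ < 1 := Real.rpow_lt_one hk0.le (hkr.trans hr) (by norm_num)
  have hkτ : ‖k‖ ≤ τ := Real.self_le_rpow_of_le_one hk0.le (hkr.trans hr).le (by norm_num)
  have hsum : dist (P b) (P c) + τ * D < σ := by
    linarith [mul_le_mul_of_nonneg_right hτr hD]
  have hτD : K * (3 * K * D + 1) * τ ≤ 1 :=
    (mul_le_mul_of_nonneg_left hτr (by positivity)).trans hrD
  have hdiff := h.secondDiff_sq_dist_le hN hσ (hball hb) (hball hadd) (hball hsub) hsum (hy b hb)
    ⟨by positivity, hτ1⟩ hkτ hτD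
  have hsq : τ ^ 2 = ‖k‖ ^ (4 / 3 : ℝ) := by
    rw [hτ, ← Real.rpow_mul_natCast hk0.le]; norm_num
  have hdiv : ‖k‖ ^ 2 / τ = ‖k‖ ^ (4 / 3 : ℝ) := by
    rw [hτ, ← Real.rpow_natCast, ← Real.rpow_sub hk0]; norm_num
  rw [hsq, hdiv] at hdiff
  linarith

lemma exists_semiconcaveOn_sq_dist (hN : HasAlmostIntermediatePoints N) (D : ℝ) :
    ∃ r > 0, ∃ C, ∀ y, dist (P c) y ≤ D →
      SemiconcaveOn (ball c r) (4 / 3) C fun z ↦ dist (P z) y ^ 2 := by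
  obtain ⟨σ, hσ, hsub⟩ := h.exists_ball_subset
  have hK := h.one_le
  obtain ⟨r, ⟨hrR, hr1, hrK, hrσ, hrD⟩, hr⟩ : ∃ r : ℝ, (r < R ∧ r < 1 ∧ 3 * K * r < 1 ∧
      3 * K * r + r ^ (2 / 3 : ℝ) * (D + 1) < σ ∧
      K * (3 * K * (D + 1) + 1) * r ^ (2 / 3 : ℝ) < 1) ∧ 0 < r := by
    have hlin : Tendsto (fun r : ℝ ↦ 3 * K * r) (𝓝 0) (𝓝 0) :=
      Continuous.tendsto' (by fun_prop) _ _ (mul_zero _)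
    have hpow : Tendsto (fun r : ℝ ↦ r ^ (2 / 3 : ℝ)) (𝓝 0) (𝓝 0) :=
      (Real.continuous_rpow_const (by norm_num)).tendsto' _ _ (Real.zero_rpow (by norm_num))
    have hev := (eventually_lt_nhds h.radius_pos).and <| (eventually_lt_nhds one_pos).and <|
      (hlin.eventually_lt_const one_pos).and <|
      ((hlin.add (hpow.mul_const (D + 1))).eventually_lt_const (by simpa using hσ)).and <|
      (hpow.const_mul (K * (3 * K * (D + 1) + 1))).eventually_lt_const
        (by rw [mul_zero]; exact one_pos)
    exact ((hev.filter_mono nhdsWithin_le_nhds).and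
      (self_mem_nhdsWithin : Ioi (0 : ℝ) ∈ 𝓝[>] 0)).exists
  refine ⟨r, hr, _, fun y hy ↦
    h.semiconcaveOn_sq_dist hN hsub hrR.le hr1 hrσ.le hrD.le fun b hb ↦ ?_⟩
  calc dist (P b) y ≤ dist (P b) (P c) + dist (P c) y := dist_triangle _ _ _
    _ ≤ 3 * K * ‖c - b‖ + D := add_le_add (h.dist_le_mul_norm
        (ball_subset_ball hrR.le hb) (mem_ball_self h.radius_pos)) hy
    _ ≤ 3 * K * r + D := by gcongr; exact (mem_ball_iff_norm'.1 hb).le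
    _ ≤ D + 1 := by linarith

end IsAlmostIsometric

end SquaredDistance

section HopfLax

lemma abs_iInf_sub_iInf_le {ι : Type*} [Nonempty ι] {f g : ι → ℝ} (hf : BddBelow (range f))
    (hg : BddBelow (range g)) {c : ℝ} (h : ∀ i, |f i - g i| ≤ c) :
    |(⨅ i, f i) - ⨅ i, g i| ≤ c := by
  have hfg : (⨅ i, f i) - c ≤ ⨅ i, g i := le_ciInf fun i ↦ by
    linarith [ciInf_le hf i, (abs_le.1 (h i)).2]
  have hgf : (⨅ i, g i) - c ≤ ⨅ i, f i := le_ciInf fun i ↦ by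
    linarith [ciInf_le hg i, (abs_le.1 (h i)).1]
  exact abs_le.2 ⟨by linarith, by linarith⟩

variable {N : Type*} [MetricSpace N] {M : Set N} {u : M → ℝ}

/-- The infimal convolution of `u : M → ℝ` with `d²/2` on the whole ambient space. The conjugate
`conj M u` is the restriction of `-hopfLax M u` to `M`. -/
def hopfLax (M : Set N) (u : M → ℝ) (x : N) : ℝ :=
  ⨅ y : M, (dist x (y : N) ^ 2 / 2 + u y)

lemma bddBelow_range_sq_dist_add (hu : BddBelow (range u)) (x : N) :
    BddBelow (range fun y : M ↦ dist x (y : N) ^ 2 / 2 + u y) := by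
  obtain ⟨b, hb⟩ := hu
  refine ⟨b, ?_⟩
  rintro _ ⟨y, rfl⟩
  exact le_add_of_nonneg_of_le (by positivity) (hb (mem_range_self y))

lemma abs_hopfLax_sub_hopfLax_le {v : M → ℝ} (hu : BddBelow (range u)) (hv : BddBelow (range v))
    {c : ℝ} (hc : 0 ≤ c) (h : ∀ y, |u y - v y| ≤ c) (x : N) :
    |hopfLax M u x - hopfLax M v x| ≤ c := by
  cases isEmpty_or_nonempty M
  · simpa [hopfLax] using hc
  · exact abs_iInf_sub_iInf_le (bddBelow_range_sq_dist_add hu x) (bddBelow_range_sq_dist_add hv x)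
      fun y ↦ by simpa using h y

lemma tendstoUniformly_hopfLax {ι : Type*} {l : Filter ι} {u : ι → M → ℝ} {v : M → ℝ}
    (hu : ∀ i, BddBelow (range (u i))) (hv : BddBelow (range v)) (h : TendstoUniformly u v l) :
    TendstoUniformly (fun i ↦ hopfLax M (u i)) (hopfLax M v) l := by
  rw [Metric.tendstoUniformly_iff] at h ⊢
  refine fun ε hε ↦ (h (ε / 2) (half_pos hε)).mono fun i hi x ↦ ?_
  exact (abs_hopfLax_sub_hopfLax_le hv (hu i) (half_pos hε).le (fun y ↦ (hi y).le) x).trans_lt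
    (half_lt_self hε)

lemma lipschitzOnWith_hopfLax (hu : BddBelow (range u)) {s : Set N} {L : ℝ≥0}
    (hs : ∀ x ∈ s, ∀ y ∈ M, dist x y ≤ L) : LipschitzOnWith L (hopfLax M u) s := by
  refine LipschitzOnWith.of_dist_le_mul fun x hx x' hx' ↦ ?_
  cases isEmpty_or_nonempty M
  · simpa [hopfLax] using mul_nonneg L.2 (dist_nonneg (x := x) (y := x'))
  refine abs_iInf_sub_iInf_le (bddBelow_range_sq_dist_add hu x) (bddBelow_range_sq_dist_add hu x')
    fun y ↦ ?_
  have hfactor : dist x y ^ 2 / 2 - dist x' y ^ 2 / 2 =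
      (dist x y + dist x' y) / 2 * (dist x y - dist x' y) := by ring
  rw [add_sub_add_right_eq_sub, hfactor, abs_mul, abs_of_nonneg (by positivity)]
  gcongr
  · linarith [hs x hx y y.2, hs x' hx' y y.2]
  · exact abs_dist_sub_le x x' y

lemma locallyLipschitz_hopfLax (hM : Bornology.IsBounded M) (hu : BddBelow (range u)) :
    LocallyLipschitz (hopfLax M u) := by
  intro x
  obtain ⟨D, hD⟩ := hM.subset_closedBall x
  refine ⟨(1 + D).toNNReal, ball x 1, ball_mem_nhds x one_pos,
    lipschitzOnWith_hopfLax hu fun z hz y hy ↦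
      (?_ : dist z y ≤ 1 + D).trans (Real.le_coe_toNNReal _)⟩
  exact (dist_triangle_right z y x).trans (add_le_add (mem_ball.1 hz).le (hD hy))

lemma lipschitzWith_conj (hM : Bornology.IsBounded M) (hu : BddBelow (range u)) :
    LipschitzWith (diam M).toNNReal (conj M u) :=
  (lipschitzOnWith_iff_restrict.1 <| lipschitzOnWith_hopfLax hu fun _ hx _ hy ↦
    (dist_le_diam_of_mem hM hx hy).trans (Real.le_coe_toNNReal _)).neg

lemma conj_mem_convexFunctions (hu : BddBelow (range u)) : conj M u ∈ convexFunctions M :=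
  ⟨u, fun x ↦ by
    have : Nonempty M := ⟨x⟩
    simpa only [conj, neg_neg] using isGLB_ciInf (bddBelow_range_sq_dist_add hu (x : N))⟩

lemma exists_eq_conj_of_mem_convexFunctions (hM : Bornology.IsBounded M) {φ : M → ℝ}
    (hφ : φ ∈ convexFunctions M) : ∃ ψ, BddBelow (range ψ) ∧ φ = conj M ψ := by
  obtain ⟨ψ, hψ⟩ := hφ
  refine ⟨ψ, ?_, funext fun x ↦ ?_⟩
  · obtain hM' | ⟨⟨x⟩⟩ := isEmpty_or_nonempty M
    · simp [range_eq_empty]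
    refine ⟨-φ x - diam M ^ 2 / 2, ?_⟩
    rintro _ ⟨y, rfl⟩
    have hdiam : dist (x : N) y ^ 2 ≤ diam M ^ 2 := by
      gcongr
      exact dist_le_diam_of_mem hM x.2 y.2
    linarith [(hψ x).1 (mem_range_self y)]
  · have : Nonempty M := ⟨x⟩
    rw [conj, (hψ x).ciInf_eq, neg_neg]

lemma lipschitzWith_of_mem_convexFunctions (hM : Bornology.IsBounded M) {φ : M → ℝ}
    (hφ : φ ∈ convexFunctions M) : LipschitzWith (diam M).toNNReal φ := by
  obtain ⟨ψ, hψ, rfl⟩ := exists_eq_conj_of_mem_convexFunctions hM hφ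
  exact lipschitzWith_conj hM hψ

lemma bddBelow_range_of_mem_convexFunctions (hM : Bornology.IsBounded M) {φ : M → ℝ}
    (hφ : φ ∈ convexFunctions M) : BddBelow (range φ) := by
  have hM' : Bornology.IsBounded (univ : Set M) := by
    rwa [← Bornology.isBounded_image_subtype_val, image_univ, Subtype.range_coe]
  have hlip := lipschitzWith_of_mem_convexFunctions hM hφ
  simpa only [image_univ] using (hlip.isBounded_image hM').bddBelow

lemma IsAlmostIsometric.exists_semiconcaveOn_hopfLax {E : Type*} [NormedAddCommGroup E]
    [NormedSpace ℝ E] {P : E → N} {p : E → Seminorm ℝ E} {c : E} {R K : ℝ}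
    (h : IsAlmostIsometric P p c R K) (hN : HasAlmostIntermediatePoints N)
    [Nonempty M] (hM : Bornology.IsBounded M) :
    ∃ r > 0, ∃ C, ∀ u : M → ℝ, BddBelow (range u) →
      SemiconcaveOn (ball c r) (4 / 3) C (hopfLax M u ∘ P) := by
  obtain ⟨D, hD⟩ := hM.subset_closedBall (P c)
  obtain ⟨r, hr, C, hC⟩ := h.exists_semiconcaveOn_sq_dist hN D
  refine ⟨r, hr, C / 2, fun u hu ↦ ?_⟩
  refine SemiconcaveOn.ciInf (fun z _ ↦ bddBelow_range_sq_dist_add hu (P z))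
    fun y b k hb hadd hsub ↦ ?_
  have := hC y (dist_comm (y : N) _ ▸ hD y.2) b k hb hadd hsub
  dsimp only at this ⊢
  linarith

end HopfLax

section Length

variable {E : Type*} [NormedAddCommGroup E] [NormedSpace ℝ E] {H : Type*} [TopologicalSpace H]
  {I : ModelWithCorners ℝ E H} {N : Type*} [PseudoMetricSpace N] [ChartedSpace H N]
  [RiemannianBundle (fun x : N ↦ TangentSpace I x)]

variable {F : Type*} [NormedAddCommGroup F] [NormedSpace ℝ F] {f : N → F}
  {f' : ∀ y : N, TangentSpace I y →L[ℝ] F} {L : ℝ}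

lemma enorm_sub_le_mul_pathELength {s : Set N} (hf : ContMDiffOn I 𝓘(ℝ, F) 1 f s)
    (hf' : ∀ y ∈ s, HasMFDerivAt I 𝓘(ℝ, F) f y (f' y)) (hL0 : 0 ≤ L)
    (hL : ∀ y ∈ s, ∀ v, ‖f' y v‖ ≤ L * ‖v‖) {γ : ℝ → N}
    (hγ : ContMDiffOn 𝓘(ℝ, ℝ) I 1 γ (Icc 0 1)) (hγs : MapsTo γ (Icc 0 1) s) :
    ‖f (γ 1) - f (γ 0)‖ₑ ≤ ENNReal.ofReal L * pathELength I γ 0 1 := by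
  have hcomp : ContDiffOn ℝ 1 (f ∘ γ) (Icc 0 1) := contMDiffOn_iff_contDiffOn.1 (hf.comp hγ hγs)
  have hderiv : ∀ t ∈ Icc (0 : ℝ) 1, derivWithin (f ∘ γ) (Icc 0 1) t =
      f' (γ t) (mfderivWithin 𝓘(ℝ, ℝ) I γ (Icc 0 1) t 1) := by
    intro t ht
    have hchain : HasFDerivWithinAt (f ∘ γ) (f' (γ t) ∘L mfderivWithin 𝓘(ℝ, ℝ) I γ (Icc 0 1) t)
        (Icc 0 1) t := ((hf' _ (hγs ht)).comp_hasMFDerivWithinAt t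
      (hγ.mdifferentiableOn one_ne_zero t ht).hasMFDerivWithinAt).hasFDerivWithinAt
    exact hchain.hasDerivWithinAt.derivWithin
      (uniqueDiffOn_Icc zero_lt_one t ht)
  calc ‖f (γ 1) - f (γ 0)‖ₑ ≤ ∫⁻ t in Icc (0 : ℝ) 1, ‖derivWithin (f ∘ γ) (Icc 0 1) t‖ₑ :=
        enorm_sub_le_lintegral_derivWithin_Icc_of_contDiffOn_Icc hcomp zero_le_one
    _ ≤ ∫⁻ t in Icc (0 : ℝ) 1, ENNReal.ofReal L *
          ‖mfderivWithin 𝓘(ℝ, ℝ) I γ (Icc 0 1) t 1‖ₑ := by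
        refine setLIntegral_mono' measurableSet_Icc fun t ht ↦ ?_
        rw [hderiv t ht, ← ofReal_norm, ← ofReal_norm, ← ENNReal.ofReal_mul hL0]
        exact ENNReal.ofReal_le_ofReal (hL _ (hγs ht) _)
    _ = ENNReal.ofReal L * pathELength I γ 0 1 := by
        rw [lintegral_const_mul' _ _ ENNReal.ofReal_ne_top,
          pathELength_eq_lintegral_mfderivWithin_Icc]

variable [IsRiemannianManifold I N]

lemma edist_le_pathELength {γ : ℝ → N} {a b : ℝ} (hγ : ContMDiffOn 𝓘(ℝ, ℝ) I 1 γ (Icc a b))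
    (hab : a ≤ b) : edist (γ a) (γ b) ≤ pathELength I γ a b := by
  rw [IsRiemannianManifold.out (I := I)]
  exact riemannianEDist_le_pathELength hγ rfl rfl hab

variable (I) in
lemma exists_contMDiffOn_pathELength_lt {x y : N} {r : ℝ} (h : dist x y < r) :
    ∃ γ : ℝ → N, γ 0 = x ∧ γ 1 = y ∧ ContMDiffOn 𝓘(ℝ, ℝ) I 1 γ (Icc 0 1) ∧
      pathELength I γ 0 1 < ENNReal.ofReal r := by
  apply exists_lt_of_riemannianEDist_lt
  rwa [← IsRiemannianManifold.out (I := I), edist_lt_ofReal]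

variable (I N) in
include I in
lemma hasAlmostIntermediatePoints_of_isRiemannianManifold : HasAlmostIntermediatePoints N := by
  intro x y τ hτ η hη
  obtain ⟨γ, rfl, rfl, hγ, hlen⟩ :=
    exists_contMDiffOn_pathELength_lt I (lt_add_of_pos_right (dist x y) hη)
  have hcont : ContinuousOn (fun t ↦ dist (γ 0) (γ t)) (Icc 0 1) :=
    (continuous_const.dist continuous_id).comp_continuousOn hγ.continuousOn
  obtain ⟨t, ht, htτ⟩ := intermediate_value_Icc zero_le_one hcont
    (show τ * dist (γ 0) (γ 1) ∈ Icc (dist (γ 0) (γ 0)) (dist (γ 0) (γ 1)) by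
      rw [dist_self]
      exact ⟨mul_nonneg hτ.1 dist_nonneg, mul_le_of_le_one_left dist_nonneg hτ.2⟩)
  dsimp only at htτ
  refine ⟨γ t, htτ, ?_⟩
  have hsplit : edist (γ 0) (γ t) + edist (γ t) (γ 1) < ENNReal.ofReal (dist (γ 0) (γ 1) + η) := by
    refine lt_of_le_of_lt ?_ hlen
    rw [← pathELength_add ht.1 ht.2]
    exact add_le_add (edist_le_pathELength (hγ.mono (Icc_subset_Icc_right ht.2)) ht.1)
      (edist_le_pathELength (hγ.mono (Icc_subset_Icc_left ht.1)) ht.2)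
  rw [edist_dist, edist_dist, ← ENNReal.ofReal_add dist_nonneg dist_nonneg,
    ENNReal.ofReal_lt_ofReal_iff_of_nonneg (by positivity), htτ] at hsplit
  linarith

lemma dist_le_of_norm_mfderivWithin_le {γ : ℝ → N} (hγ : ContMDiffOn 𝓘(ℝ, ℝ) I 1 γ (Icc 0 1))
    {L : ℝ} (hL : ∀ t ∈ Icc (0 : ℝ) 1, ‖mfderivWithin 𝓘(ℝ, ℝ) I γ (Icc 0 1) t 1‖ ≤ L) :
    dist (γ 0) (γ 1) ≤ L := by
  have hL0 : 0 ≤ L := (norm_nonneg _).trans (hL 0 (left_mem_Icc.2 zero_le_one))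
  rw [← edist_le_ofReal hL0]
  calc edist (γ 0) (γ 1) ≤ pathELength I γ 0 1 := edist_le_pathELength hγ zero_le_one
    _ ≤ ∫⁻ _ in Icc (0 : ℝ) 1, ENNReal.ofReal L := by
        rw [pathELength_eq_lintegral_mfderivWithin_Icc]
        refine setLIntegral_mono' measurableSet_Icc fun t ht ↦ ?_
        rw [← ofReal_norm]
        exact ENNReal.ofReal_le_ofReal (hL t ht)
    _ = ENNReal.ofReal L := by simp

lemma norm_sub_le_mul_dist_of_norm_mfderiv_le {x x' : N} {r : ℝ}
    (hf : ContMDiffOn I 𝓘(ℝ, F) 1 f (ball x r))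
    (hf' : ∀ y ∈ ball x r, HasMFDerivAt I 𝓘(ℝ, F) f y (f' y)) (hL0 : 0 ≤ L)
    (hL : ∀ y ∈ ball x r, ∀ v, ‖f' y v‖ ≤ L * ‖v‖) (hx' : dist x x' < r) :
    ‖f x' - f x‖ ≤ L * dist x x' := by
  have hlt : ∀ ρ ∈ Ioo (dist x x') r, ‖f x' - f x‖ ≤ L * ρ := by
    rintro ρ ⟨hρ, hρr⟩
    obtain ⟨γ, rfl, rfl, hγ, hlen⟩ := exists_contMDiffOn_pathELength_lt I hρ
    have hball : MapsTo γ (Icc 0 1) (ball (γ 0) r) := by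
      intro t ht
      rw [mem_ball', ← edist_lt_ofReal]
      calc edist (γ 0) (γ t) ≤ pathELength I γ 0 t :=
            edist_le_pathELength (hγ.mono (Icc_subset_Icc_right ht.2)) ht.1
        _ ≤ pathELength I γ 0 1 := pathELength_mono le_rfl ht.2
        _ < ENNReal.ofReal r := hlen.trans_le (ENNReal.ofReal_le_ofReal hρr.le)
    have hle := (enorm_sub_le_mul_pathELength hf hf' hL0 hL hγ hball).trans
      (mul_le_mul_right hlen.le _)
    rwa [← ENNReal.ofReal_mul hL0, ← ofReal_norm, ENNReal.ofReal_le_ofReal_iff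
      (mul_nonneg hL0 (dist_nonneg.trans hρ.le))] at hle
  have hlim : Tendsto (fun ρ ↦ L * ρ) (𝓝[>] dist x x') (𝓝 (L * dist x x')) :=
    ((continuous_const_mul L).tendsto _).mono_left nhdsWithin_le_nhds
  exact ge_of_tendsto hlim (mem_of_superset (Ioo_mem_nhdsGT hx') hlt)

end Length

section Charts

variable {E : Type*} [NormedAddCommGroup E] [NormedSpace ℝ E] {N : Type*} [PseudoMetricSpace N]
  [ChartedSpace E N]

/-- The tangent vectors at the point with coordinates `z` in the preferred chart at `x₀`,
parametrized by their coordinates. -/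
def frame (x₀ : N) (z : E) : E →L[ℝ] TangentSpace 𝓘(ℝ, E) ((extChartAt 𝓘(ℝ, E) x₀).symm z) :=
  mfderivWithin 𝓘(ℝ, E) 𝓘(ℝ, E) (extChartAt 𝓘(ℝ, E) x₀).symm (range 𝓘(ℝ, E)) z

/-- The coordinates, in the preferred chart at `x₀`, of the tangent vectors at `y`. -/
def coframe (x₀ y : N) : TangentSpace 𝓘(ℝ, E) y →L[ℝ] E :=
  mfderiv 𝓘(ℝ, E) 𝓘(ℝ, E) (extChartAt 𝓘(ℝ, E) x₀) y

section Frame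

variable [IsManifold 𝓘(ℝ, E) 1 N] {x₀ : N}

lemma hasMFDerivAt_extChartAt_coframe {y : N} (hy : y ∈ (extChartAt 𝓘(ℝ, E) x₀).source) :
    HasMFDerivAt 𝓘(ℝ, E) 𝓘(ℝ, E) (extChartAt 𝓘(ℝ, E) x₀) y (coframe x₀ y) :=
  (mdifferentiableAt_extChartAt (by rwa [← extChartAt_source 𝓘(ℝ, E)])).hasMFDerivAt

lemma hasMFDerivAt_extChartAt_symm_frame {z : E} (hz : z ∈ (extChartAt 𝓘(ℝ, E) x₀).target) :
    HasMFDerivAt 𝓘(ℝ, E) 𝓘(ℝ, E) (extChartAt 𝓘(ℝ, E) x₀).symm z (frame x₀ z) := by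
  have h := (mdifferentiableWithinAt_extChartAt_symm (I := 𝓘(ℝ, E)) hz).hasMFDerivWithinAt
  exact h.hasMFDerivAt (by simp)

lemma coframe_frame {z : E} (hz : z ∈ (extChartAt 𝓘(ℝ, E) x₀).target) (w : E) :
    coframe x₀ ((extChartAt 𝓘(ℝ, E) x₀).symm z) (frame x₀ z w) = w :=
  DFunLike.congr_fun (mfderiv_extChartAt_comp_mfderivWithin_extChartAt_symm hz) w

lemma frame_coframe {z : E} (hz : z ∈ (extChartAt 𝓘(ℝ, E) x₀).target)
    (v : TangentSpace 𝓘(ℝ, E) ((extChartAt 𝓘(ℝ, E) x₀).symm z)) :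
    frame x₀ z (coframe x₀ ((extChartAt 𝓘(ℝ, E) x₀).symm z) v) = v :=
  DFunLike.congr_fun (mfderivWithin_extChartAt_symm_comp_mfderiv_extChartAt hz) v

end Frame

variable [RiemannianBundle (fun x : N ↦ TangentSpace 𝓘(ℝ, E) x)]

/-- The Riemannian metric in the preferred chart at `x₀`: the length of the tangent vector with
coordinates `w` at the point with coordinates `z`, as a seminorm in `w`. -/
def chartNorm (x₀ : N) (z : E) : Seminorm ℝ E :=
  (normSeminorm ℝ (TangentSpace 𝓘(ℝ, E) ((extChartAt 𝓘(ℝ, E) x₀).symm z))).comp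
    (frame x₀ z).toLinearMap

lemma chartNorm_apply (x₀ : N) (z w : E) : chartNorm x₀ z w = ‖frame x₀ z w‖ :=
  rfl

lemma chartNorm_parallelogram (x₀ : N) (z u v : E) : chartNorm x₀ z (u - v) ^ 2 +
    chartNorm x₀ z (u + v) ^ 2 = 2 * chartNorm x₀ z u ^ 2 + 2 * chartNorm x₀ z v ^ 2 := by
  simp only [chartNorm_apply, map_sub, map_add, sq]
  linear_combination parallelogram_law_with_norm ℝ (frame x₀ z u) (frame x₀ z v)

variable [IsManifold 𝓘(ℝ, E) 1 N]

lemma chartNorm_coframe {x₀ y : N} (hy : y ∈ (extChartAt 𝓘(ℝ, E) x₀).source)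
    (v : TangentSpace 𝓘(ℝ, E) y) :
    chartNorm x₀ (extChartAt 𝓘(ℝ, E) x₀ y) (coframe x₀ y v) = ‖v‖ := by
  obtain ⟨z, hz, rfl⟩ : ∃ z ∈ (extChartAt 𝓘(ℝ, E) x₀).target, (extChartAt 𝓘(ℝ, E) x₀).symm z = y :=
    ⟨_, (extChartAt 𝓘(ℝ, E) x₀).map_source hy, (extChartAt 𝓘(ℝ, E) x₀).left_inv hy⟩
  rw [(extChartAt 𝓘(ℝ, E) x₀).right_inv hz, chartNorm_apply, frame_coframe hz]

lemma chartNorm_self (x : N) (v : TangentSpace 𝓘(ℝ, E) x) :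
    chartNorm x (extChartAt 𝓘(ℝ, E) x x) (v : E) = ‖v‖ := by
  have hv : coframe x x v = v := by
    rw [coframe, mfderiv_extChartAt_self]
    rfl
  have h := chartNorm_coframe (mem_extChartAt_source (I := 𝓘(ℝ, E)) x) v
  rwa [hv] at h

section Distance

variable [IsRiemannianManifold 𝓘(ℝ, E) N] {x₀ : N}

lemma dist_extChartAt_symm_le {z z' : E} {L : ℝ}
    (hs : segment ℝ z z' ⊆ (extChartAt 𝓘(ℝ, E) x₀).target)
    (hL : ∀ q ∈ segment ℝ z z', chartNorm x₀ q (z' - z) ≤ L) :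
    dist ((extChartAt 𝓘(ℝ, E) x₀).symm z) ((extChartAt 𝓘(ℝ, E) x₀).symm z') ≤ L := by
  set ℓ : ℝ → E := fun t ↦ AffineMap.lineMap z z' t with hℓ
  have hmaps : MapsTo ℓ (Icc 0 1) (segment ℝ z z') := by
    rw [segment_eq_image_lineMap]
    exact mapsTo_image _ _
  have hline : ContMDiffOn 𝓘(ℝ, ℝ) 𝓘(ℝ, E) 1 ℓ (Icc 0 1) :=
    (ContinuousAffineMap.lineMap (R := ℝ) z z').contDiff.contDiffOn.contMDiffOn
  have hγ : ContMDiffOn 𝓘(ℝ, ℝ) 𝓘(ℝ, E) 1 ((extChartAt 𝓘(ℝ, E) x₀).symm ∘ ℓ) (Icc 0 1) :=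
    (contMDiffOn_extChartAt_symm x₀).comp hline fun t ht ↦ hs (hmaps ht)
  have hderiv : ∀ t ∈ Icc (0 : ℝ) 1, mfderivWithin 𝓘(ℝ, ℝ) 𝓘(ℝ, E)
      ((extChartAt 𝓘(ℝ, E) x₀).symm ∘ ℓ) (Icc 0 1) t 1 = frame x₀ (ℓ t) (z' - z) := by
    intro t ht
    have hℓ' : HasMFDerivWithinAt 𝓘(ℝ, ℝ) 𝓘(ℝ, E) ℓ (Icc 0 1) t
        ((1 : ℝ →L[ℝ] ℝ).smulRight (z' - z)) :=
      AffineMap.hasDerivWithinAt_lineMap.hasFDerivWithinAt.hasMFDerivWithinAt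
    have hcomp := (hasMFDerivAt_extChartAt_symm_frame (hs (hmaps ht))).comp_hasMFDerivWithinAt t hℓ'
    rw [hcomp.mfderivWithin (uniqueDiffOn_Icc zero_lt_one t ht).uniqueMDiffWithinAt]
    exact congr_arg (frame x₀ (ℓ t)) (one_smul ℝ (z' - z))
  have hlen := dist_le_of_norm_mfderivWithin_le hγ fun t ht ↦
    (congr_arg norm (hderiv t ht)).trans_le (hL _ (hmaps ht))
  simpa [hℓ] using hlen

lemma norm_map_extChartAt_sub_le {F : Type*} [NormedAddCommGroup F] [NormedSpace ℝ F]
    (T : E →L[ℝ] F) {x x' : N} {r L : ℝ} (hr : ball x r ⊆ (extChartAt 𝓘(ℝ, E) x₀).source)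
    (hL0 : 0 ≤ L)
    (hL : ∀ y ∈ ball x r, ∀ w, ‖T w‖ ≤ L * chartNorm x₀ (extChartAt 𝓘(ℝ, E) x₀ y) w)
    (hx' : dist x x' < r) :
    ‖T (extChartAt 𝓘(ℝ, E) x₀ x' - extChartAt 𝓘(ℝ, E) x₀ x)‖ ≤ L * dist x x' := by
  have hsmooth : ContMDiffOn 𝓘(ℝ, E) 𝓘(ℝ, E) 1 (extChartAt 𝓘(ℝ, E) x₀) (ball x r) :=
    contMDiffOn_extChartAt.mono (by rwa [← extChartAt_source 𝓘(ℝ, E)])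
  rw [map_sub]
  refine norm_sub_le_mul_dist_of_norm_mfderiv_le (f := T ∘ extChartAt 𝓘(ℝ, E) x₀)
    (f' := fun y ↦ T ∘L coframe x₀ y) (T.contMDiff.comp_contMDiffOn hsmooth)
    (fun y hy ↦ T.hasMFDerivAt.comp y (hasMFDerivAt_extChartAt_coframe (hr hy)))
    hL0 (fun y hy v ↦ ?_) hx'
  rw [← chartNorm_coframe (hr hy) v]
  exact hL y hy _

end Distance

end Charts

section ChartBound

variable {E : Type*} [NormedAddCommGroup E] [NormedSpace ℝ E] {N : Type*} [PseudoMetricSpace N]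
  [ChartedSpace E N] [RiemannianBundle (fun x : N ↦ TangentSpace 𝓘(ℝ, E) x)]

/-- Control of the Riemannian metric on the ball of radius `R` in the preferred chart at `x₀`: it is
comparable to the norm of the model space, and it depends on the point in a Lipschitz way. -/
structure ChartBound (x₀ : N) (R K : ℝ) : Prop where
  radius_pos : 0 < R
  one_le : 1 ≤ K
  ball_subset : ball (extChartAt 𝓘(ℝ, E) x₀ x₀) R ⊆ (extChartAt 𝓘(ℝ, E) x₀).target
  chartNorm_le : ∀ z ∈ ball (extChartAt 𝓘(ℝ, E) x₀ x₀) R, ∀ w, chartNorm x₀ z w ≤ K * ‖w‖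
  le_chartNorm : ∀ z ∈ ball (extChartAt 𝓘(ℝ, E) x₀ x₀) R, ∀ w, ‖w‖ ≤ K * chartNorm x₀ z w
  chartNorm_le_mul : ∀ z ∈ ball (extChartAt 𝓘(ℝ, E) x₀ x₀) R,
    ∀ z' ∈ ball (extChartAt 𝓘(ℝ, E) x₀ x₀) R, ∀ w,
      chartNorm x₀ z w ≤ (1 + K * ‖z - z'‖) * chartNorm x₀ z' w

variable [IsManifold 𝓘(ℝ, E) 1 N]

section Existence

set_option synthInstance.maxHeartbeats 200000 in
-- needed for the instances on the fibres of the iterated bundle of bilinear forms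
lemma exists_sq_chartNorm_sub_le
    [IsContMDiffRiemannianBundle 𝓘(ℝ, E) 1 E (fun x : N ↦ TangentSpace 𝓘(ℝ, E) x)] (x₀ : N) :
    ∃ C : ℝ≥0, ∃ t ∈ 𝓝 (extChartAt 𝓘(ℝ, E) x₀ x₀), ∀ z ∈ t, ∀ z' ∈ t, ∀ w,
      chartNorm x₀ z w ^ 2 - chartNorm x₀ z' w ^ 2 ≤ C * ‖z - z'‖ * ‖w‖ ^ 2 := by
  obtain ⟨g, hg, hgi⟩ := IsContMDiffRiemannianBundle.exists_contMDiff (IB := 𝓘(ℝ, E)) (n := 1)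
    (F := E) (E := fun x : N ↦ TangentSpace 𝓘(ℝ, E) x)
  set G : E → E →L[ℝ] E →L[ℝ] ℝ := fun z ↦ (trivializationAt (E →L[ℝ] E →L[ℝ] ℝ)
    (fun x : N ↦ TangentSpace 𝓘(ℝ, E) x →L[ℝ] TangentSpace 𝓘(ℝ, E) x →L[ℝ] ℝ) x₀
      ⟨(extChartAt 𝓘(ℝ, E) x₀).symm z, g ((extChartAt 𝓘(ℝ, E) x₀).symm z)⟩).2 with hG
  have hGsmooth : ContDiffAt ℝ 1 G (extChartAt 𝓘(ℝ, E) x₀ x₀) := by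
    have h := (contMDiffAt_iff.1 ((contMDiffAt_section x₀).1 (hg x₀))).2
    rwa [ModelWithCorners.range_eq_univ, contDiffWithinAt_univ] at h
  have hGnorm : ∀ z ∈ (extChartAt 𝓘(ℝ, E) x₀).target, ∀ w, G z w w = chartNorm x₀ z w ^ 2 := by
    intro z hz w
    have hz' : (extChartAt 𝓘(ℝ, E) x₀).symm z ∈ (chartAt E x₀).source := by
      simpa using (extChartAt 𝓘(ℝ, E) x₀).map_target hz
    have hframe : (trivializationAt E (TangentSpace 𝓘(ℝ, E)) x₀).symm
        ((extChartAt 𝓘(ℝ, E) x₀).symm z) w = frame x₀ z w := by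
      have h := TangentBundle.symmL_trivializationAt (I := 𝓘(ℝ, E)) hz'
      rw [(extChartAt 𝓘(ℝ, E) x₀).right_inv hz] at h
      rw [← Trivialization.symmL_apply (R := ℝ) _ (by simpa using hz'), h]
      rfl
    simp only [hG]
    rw [hom_trivializationAt_apply]
    simp only
    rw [inCoordinates_apply_eq₂ (by simpa using hz') (by simpa using hz') (by simp), hframe,
      chartNorm_apply, ← real_inner_self_eq_norm_sq, hgi]
    simp
  obtain ⟨C, t, ht, hC⟩ := hGsmooth.exists_lipschitzOnWith
  refine ⟨C, _, inter_mem ht (extChartAt_target_mem_nhds (I := 𝓘(ℝ, E)) x₀), ?_⟩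
  rintro z ⟨hz, hzt⟩ z' ⟨hz', hzt'⟩ w
  have hdist : ‖G z - G z'‖ ≤ C * ‖z - z'‖ := by
    simpa only [dist_eq_norm] using hC.dist_le_mul z hz z' hz'
  rw [← hGnorm z hzt, ← hGnorm z' hzt']
  calc G z w w - G z' w w = (G z - G z') w w := by simp
    _ ≤ ‖G z - G z'‖ * ‖w‖ * ‖w‖ := (Real.le_norm_self _).trans ((G z - G z').le_opNorm₂ w w)
    _ ≤ C * ‖z - z'‖ * ‖w‖ ^ 2 := by
        rw [mul_assoc, ← sq]
        gcongr

lemma exists_chartNorm_le_and_le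
    [IsContinuousRiemannianBundle E (fun x : N ↦ TangentSpace 𝓘(ℝ, E) x)] (x₀ : N) :
    ∃ K ≥ 0, ∀ᶠ z in 𝓝 (extChartAt 𝓘(ℝ, E) x₀ x₀), ∀ w,
      chartNorm x₀ z w ≤ K * ‖w‖ ∧ ‖w‖ ≤ K * chartNorm x₀ z w := by
  obtain ⟨C₁, hC₁, h₁⟩ := eventually_norm_mfderivWithin_symm_extChartAt_lt 𝓘(ℝ, E) x₀
  obtain ⟨C₂, -, h₂⟩ := eventually_norm_mfderiv_extChartAt_lt 𝓘(ℝ, E) x₀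
  rw [ModelWithCorners.range_eq_univ, nhdsWithin_univ] at h₁
  have hsymm : Tendsto (extChartAt 𝓘(ℝ, E) x₀).symm (𝓝 (extChartAt 𝓘(ℝ, E) x₀ x₀)) (𝓝 x₀) := by
    simpa only [extChartAt_to_inv] using (continuousAt_extChartAt_symm (I := 𝓘(ℝ, E)) x₀).tendsto
  refine ⟨max C₁ C₂, hC₁.le.trans (le_max_left _ _), ?_⟩
  filter_upwards [h₁, hsymm.eventually h₂, extChartAt_target_mem_nhds (I := 𝓘(ℝ, E)) x₀]
    with z hz₁ hz₂ hz w
  have hframe : ‖frame x₀ z‖ ≤ max C₁ C₂ := by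
    rw [frame, ModelWithCorners.range_eq_univ]
    exact hz₁.le.trans (le_max_left _ _)
  have hcoframe : ‖coframe x₀ ((extChartAt 𝓘(ℝ, E) x₀).symm z)‖ ≤ max C₁ C₂ :=
    hz₂.le.trans (le_max_right _ _)
  refine ⟨(frame x₀ z).le_of_opNorm_le hframe w, ?_⟩
  have hle := ContinuousLinearMap.le_of_opNorm_le _ hcoframe (frame x₀ z w)
  rwa [coframe_frame hz] at hle

lemma exists_chartBound
    [IsContMDiffRiemannianBundle 𝓘(ℝ, E) 1 E (fun x : N ↦ TangentSpace 𝓘(ℝ, E) x)] (x₀ : N) :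
    ∃ R K, ChartBound (E := E) x₀ R K := by
  have hcont : IsContinuousRiemannianBundle E (fun x : N ↦ TangentSpace 𝓘(ℝ, E) x) := by
    obtain ⟨g, hg, hgi⟩ := IsContMDiffRiemannianBundle.exists_contMDiff (IB := 𝓘(ℝ, E)) (n := 1)
      (F := E) (E := fun x : N ↦ TangentSpace 𝓘(ℝ, E) x)
    exact ⟨g, hg.continuous, hgi⟩
  obtain ⟨C, t, ht, hC⟩ := exists_sq_chartNorm_sub_le (E := E) x₀
  obtain ⟨K, hK, hbound⟩ := exists_chartNorm_le_and_le (E := E) x₀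
  obtain ⟨R, hR, hball⟩ := Metric.mem_nhds_iff.1
    (inter_mem (inter_mem ht (extChartAt_target_mem_nhds (I := 𝓘(ℝ, E)) x₀)) hbound)
  have hCK : 0 ≤ C * K ^ 2 := by positivity
  refine ⟨R, 1 + K + C * K ^ 2, hR, by linarith, fun z hz ↦ (hball hz).1.2,
    fun z hz w ↦ ((hball hz).2 w).1.trans (by gcongr; linarith),
    fun z hz w ↦ ((hball hz).2 w).2.trans (by gcongr; linarith), fun z hz z' hz' w ↦ ?_⟩
  have hsq : chartNorm x₀ z w ^ 2 ≤ (1 + C * K ^ 2 * ‖z - z'‖) * chartNorm x₀ z' w ^ 2 := by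
    have hsub := hC z (hball hz).1.1 z' (hball hz').1.1 w
    calc chartNorm x₀ z w ^ 2 ≤ chartNorm x₀ z' w ^ 2 + C * ‖z - z'‖ * ‖w‖ ^ 2 := by linarith
      _ ≤ chartNorm x₀ z' w ^ 2 + C * ‖z - z'‖ * (K * chartNorm x₀ z' w) ^ 2 := by
          gcongr
          exact ((hball hz').2 w).2
      _ = (1 + C * K ^ 2 * ‖z - z'‖) * chartNorm x₀ z' w ^ 2 := by ring
  set s := 1 + C * K ^ 2 * ‖z - z'‖ with hs
  have hs1 : 1 ≤ s := le_add_of_nonneg_right (by positivity)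
  calc chartNorm x₀ z w ≤ s * chartNorm x₀ z' w := by
        refine abs_le_of_sq_le_sq' ?_ (by positivity) |>.2
        rw [mul_pow]
        exact hsq.trans (by gcongr; exact le_self_pow₀ hs1 two_ne_zero)
    _ ≤ _ := by
        rw [hs]
        gcongr
        linarith

end Existence

namespace ChartBound

variable [IsRiemannianManifold 𝓘(ℝ, E) N] {x₀ : N} {R K : ℝ} (h : ChartBound (E := E) x₀ R K)
include h

lemma dist_le {a z z' : E} {ρ : ℝ} (ha : a ∈ ball (extChartAt 𝓘(ℝ, E) x₀ x₀) R)
    (hz : z ∈ ball (extChartAt 𝓘(ℝ, E) x₀ x₀) R) (hz' : z' ∈ ball (extChartAt 𝓘(ℝ, E) x₀ x₀) R)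
    (hza : ‖z - a‖ ≤ ρ) (hza' : ‖z' - a‖ ≤ ρ) :
    dist ((extChartAt 𝓘(ℝ, E) x₀).symm z) ((extChartAt 𝓘(ℝ, E) x₀).symm z') ≤
      (1 + K * ρ) * chartNorm x₀ a (z' - z) := by
  have hK := h.one_le
  have hseg := (convex_ball _ _).segment_subset hz hz'
  refine dist_extChartAt_symm_le (hseg.trans h.ball_subset) fun q hq ↦ ?_
  have hqa : ‖q - a‖ ≤ ρ := mem_closedBall_iff_norm.1 <| (convex_closedBall a ρ).segment_subset
    (mem_closedBall_iff_norm.2 hza) (mem_closedBall_iff_norm.2 hza') hq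
  calc chartNorm x₀ q (z' - z) ≤ (1 + K * ‖q - a‖) * chartNorm x₀ a (z' - z) :=
        h.chartNorm_le_mul q (hseg hq) a ha _
    _ ≤ (1 + K * ρ) * chartNorm x₀ a (z' - z) := by gcongr

lemma norm_extChartAt_sub_le {x x' : N} {r : ℝ} (hr : ball x r ⊆ (extChartAt 𝓘(ℝ, E) x₀).source ∩
      extChartAt 𝓘(ℝ, E) x₀ ⁻¹' ball (extChartAt 𝓘(ℝ, E) x₀ x₀) R) (hx' : dist x x' < r) :
    ‖extChartAt 𝓘(ℝ, E) x₀ x' - extChartAt 𝓘(ℝ, E) x₀ x‖ ≤ K * dist x x' :=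
  norm_map_extChartAt_sub_le (ContinuousLinearMap.id ℝ E) (hr.trans inter_subset_left)
    (zero_le_one.trans h.one_le) (fun _ hy w ↦ h.le_chartNorm _ (hr hy).2 w) hx'

lemma le_dist {a : E} {x x' : N} {r ρ : ℝ} (ha : a ∈ ball (extChartAt 𝓘(ℝ, E) x₀ x₀) R)
    (hr : ball x r ⊆ (extChartAt 𝓘(ℝ, E) x₀).source ∩
      extChartAt 𝓘(ℝ, E) x₀ ⁻¹' ball (extChartAt 𝓘(ℝ, E) x₀ x₀) R)
    (hxa : ‖extChartAt 𝓘(ℝ, E) x₀ x - a‖ ≤ ρ) (hx' : dist x x' < r) :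
    chartNorm x₀ a (extChartAt 𝓘(ℝ, E) x₀ x' - extChartAt 𝓘(ℝ, E) x₀ x) ≤
      (1 + K * (K * r + ρ)) * dist x x' := by
  have hK := h.one_le
  have hr0 : 0 < r := dist_nonneg.trans_lt hx'
  have hρ : 0 ≤ ρ := (norm_nonneg _).trans hxa
  refine norm_map_extChartAt_sub_le (frame x₀ a) (hr.trans inter_subset_left) (by positivity)
    (fun y hy w ↦ ?_) hx'
  have hay : ‖a - extChartAt 𝓘(ℝ, E) x₀ y‖ ≤ K * r + ρ := by
    rw [norm_sub_rev]
    calc ‖extChartAt 𝓘(ℝ, E) x₀ y - a‖ ≤ ‖extChartAt 𝓘(ℝ, E) x₀ y - extChartAt 𝓘(ℝ, E) x₀ x‖ +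
          ‖extChartAt 𝓘(ℝ, E) x₀ x - a‖ := norm_sub_le_norm_sub_add_norm_sub _ _ _
      _ ≤ K * dist x y + ρ := add_le_add (h.norm_extChartAt_sub_le hr (mem_ball'.1 hy)) hxa
      _ ≤ K * r + ρ := by gcongr; exact (mem_ball'.1 hy).le
  calc chartNorm x₀ a w ≤ (1 + K * ‖a - extChartAt 𝓘(ℝ, E) x₀ y‖) *
        chartNorm x₀ (extChartAt 𝓘(ℝ, E) x₀ y) w := h.chartNorm_le_mul a ha _ (hr hy).2 w
    _ ≤ _ := by gcongr

lemma dist_le_mul_norm {z z' : E} (hz : z ∈ ball (extChartAt 𝓘(ℝ, E) x₀ x₀) R)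
    (hz' : z' ∈ ball (extChartAt 𝓘(ℝ, E) x₀ x₀) R) :
    dist ((extChartAt 𝓘(ℝ, E) x₀).symm z) ((extChartAt 𝓘(ℝ, E) x₀).symm z') ≤ K * ‖z' - z‖ := by
  have hseg := (convex_ball _ _).segment_subset hz hz'
  exact dist_extChartAt_symm_le (hseg.trans h.ball_subset) fun q hq ↦ h.chartNorm_le q (hseg hq) _

lemma dist_symm_lt {r : ℝ} (hrR : r ≤ R) {z : E} (hz : z ∈ ball (extChartAt 𝓘(ℝ, E) x₀ x₀) r) :
    dist ((extChartAt 𝓘(ℝ, E) x₀).symm z) x₀ < K * r := by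
  have hK := h.one_le
  have hle := h.dist_le_mul_norm (ball_subset_ball hrR hz) (mem_ball_self h.radius_pos)
  rw [extChartAt_to_inv] at hle
  exact hle.trans_lt (by gcongr; exact mem_ball_iff_norm'.1 hz)

lemma chartNorm_sub_le_mul_dist {σ r : ℝ} (hσ : ball x₀ σ ⊆ (extChartAt 𝓘(ℝ, E) x₀).source ∩
      extChartAt 𝓘(ℝ, E) x₀ ⁻¹' ball (extChartAt 𝓘(ℝ, E) x₀ x₀) R) (hrR : r ≤ R)
    (hrσ : 5 * K * r ≤ σ) {a z z' : E} {ρ : ℝ} (ha : a ∈ ball (extChartAt 𝓘(ℝ, E) x₀ x₀) r)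
    (hz : z ∈ ball (extChartAt 𝓘(ℝ, E) x₀ x₀) r) (hz' : z' ∈ ball (extChartAt 𝓘(ℝ, E) x₀ x₀) r)
    (hza : ‖z - a‖ ≤ ρ) (hza' : ‖z' - a‖ ≤ ρ) :
    chartNorm x₀ a (z' - z) ≤ (1 + 5 * K ^ 3 * ρ) *
      dist ((extChartAt 𝓘(ℝ, E) x₀).symm z) ((extChartAt 𝓘(ℝ, E) x₀).symm z') := by
  have hK := h.one_le
  have hρ : 0 ≤ ρ := (norm_nonneg _).trans hza
  have hball := ball_subset_ball (x := extChartAt 𝓘(ℝ, E) x₀ x₀) hrR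
  have hinv : ∀ {w}, w ∈ ball (extChartAt 𝓘(ℝ, E) x₀ x₀) r →
      extChartAt 𝓘(ℝ, E) x₀ ((extChartAt 𝓘(ℝ, E) x₀).symm w) = w :=
    fun hw ↦ (extChartAt 𝓘(ℝ, E) x₀).right_inv (h.ball_subset (hball hw))
  set d := dist ((extChartAt 𝓘(ℝ, E) x₀).symm z) ((extChartAt 𝓘(ℝ, E) x₀).symm z')
  have hdr : d < 2 * K * r := by
    linarith [dist_triangle_right ((extChartAt 𝓘(ℝ, E) x₀).symm z)
      ((extChartAt 𝓘(ℝ, E) x₀).symm z') x₀, h.dist_symm_lt hrR hz, h.dist_symm_lt hrR hz']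
  have hdρ : d ≤ K * (ρ + ρ) := by
    refine (h.dist_le_mul_norm (hball hz) (hball hz')).trans ?_
    gcongr
    exact (norm_sub_le_norm_sub_add_norm_sub z' a z).trans
      (add_le_add hza' (by rwa [norm_sub_rev]))
  have hsub : ∀ s ≤ 4 * K * r, ball ((extChartAt 𝓘(ℝ, E) x₀).symm z) s ⊆ ball x₀ σ :=
    fun s hs ↦ ball_subset_ball' (by linarith [h.dist_symm_lt hrR hz])
  have hfactor : K * (K * (2 * d) + ρ) ≤ 5 * K ^ 3 * ρ := by
    calc K * (K * (2 * d) + ρ) ≤ K * (K * (2 * (K * (ρ + ρ))) + K ^ 2 * ρ) := by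
          gcongr
          exact le_mul_of_one_le_left hρ (one_le_pow₀ hK)
      _ = 5 * K ^ 3 * ρ := by ring
  obtain hd0 | hd0 := (dist_nonneg : 0 ≤ d).eq_or_lt
  · have hle := h.norm_extChartAt_sub_le ((hsub _ le_rfl).trans hσ) (by linarith)
    rw [hinv hz, hinv hz', show dist _ _ = 0 from hd0.symm, mul_zero] at hle
    rw [norm_le_zero_iff.1 hle, map_zero]
    positivity
  have hle := h.le_dist (r := 2 * d) (ρ := ρ) (hball ha) ((hsub _ (by linarith)).trans hσ)
    (by rwa [hinv hz]) (by linarith)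
  rw [hinv hz, hinv hz'] at hle
  exact hle.trans (by gcongr)

lemma exists_isAlmostIsometric : ∃ R' K', IsAlmostIsometric (extChartAt 𝓘(ℝ, E) x₀).symm
    (chartNorm x₀) (extChartAt 𝓘(ℝ, E) x₀ x₀) R' K' := by
  have hK := h.one_le
  have hR := h.radius_pos
  have hnhds : ∀ s > 0, (extChartAt 𝓘(ℝ, E) x₀).source ∩
      extChartAt 𝓘(ℝ, E) x₀ ⁻¹' ball (extChartAt 𝓘(ℝ, E) x₀ x₀) s ∈ 𝓝 x₀ := fun s hs ↦
    inter_mem (extChartAt_source_mem_nhds x₀)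
      ((continuousAt_extChartAt x₀).preimage_mem_nhds (ball_mem_nhds _ hs))
  obtain ⟨σ, hσ, hball⟩ := Metric.mem_nhds_iff.1 (hnhds R hR)
  set r := min R (min (σ / (5 * K)) (1 / (5 * K ^ 3)))
  have hr0 : 0 < r := by positivity
  have hrR : r ≤ R := min_le_left _ _
  have hrσ : 5 * K * r ≤ σ := by
    rw [← le_div_iff₀' (by positivity)]
    exact (min_le_right _ _).trans (min_le_left _ _)
  have hrK : 5 * K ^ 3 * r ≤ 1 := by
    rw [← le_div_iff₀' (by positivity)]
    exact (min_le_right _ _).trans (min_le_right _ _)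
  have hKK : K ≤ 5 * K ^ 3 := by nlinarith [sq_nonneg (K - 1)]
  have hsub := ball_subset_ball (x := extChartAt 𝓘(ℝ, E) x₀ x₀) hrR
  refine ⟨r, 5 * K ^ 3, hr0, hK.trans hKK, hrK, ?_, chartNorm_parallelogram x₀,
    fun a ha w ↦ (h.chartNorm_le a (hsub ha) w).trans (by gcongr),
    fun a ha w ↦ (h.le_chartNorm a (hsub ha) w).trans (by gcongr),
    fun a z z' ρ ha hz hz' hza hza' ↦ ?_,
    fun a z z' ρ ha hz hz' ↦ h.chartNorm_sub_le_mul_dist hball hrR hrσ ha hz hz'⟩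
  · rw [extChartAt_to_inv]
    obtain ⟨s, hs, hss⟩ := Metric.mem_nhds_iff.1 (hnhds r hr0)
    exact ⟨s, hs, fun y hy ↦ ⟨_, (hss hy).2, (extChartAt 𝓘(ℝ, E) x₀).left_inv (hss hy).1⟩⟩
  · have hρ : 0 ≤ ρ := (norm_nonneg _).trans hza
    exact (h.dist_le (hsub ha) (hsub hz) (hsub hz') hza hza').trans (by gcongr)

end ChartBound

end ChartBound

section LocalSlope

variable {X : Type*} [PseudoMetricSpace X]

/-- The largest increment of `w` over the ball of radius `r` about `x`, relative to `r`. At the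
points of differentiability of `w` it tends to the length of the gradient as `r` tends to zero. -/
def localSlope (w : X → ℝ) (r : ℝ) (x : X) : ℝ≥0∞ :=
  (⨆ y ∈ ball x r, edist (w y) (w x)) / ENNReal.ofReal r

lemma measurable_localSlope [MeasurableSpace X] [OpensMeasurableSpace X] {w : X → ℝ}
    (hw : Continuous w) (r : ℝ) : Measurable (localSlope w r) := by
  refine Measurable.div_const (LowerSemicontinuous.measurable ?_) _
  intro x a ha
  simp only [lt_iSup_iff] at ha
  obtain ⟨y, hy, hay⟩ := ha
  have hclose : ∀ᶠ x' in 𝓝 x, y ∈ ball x' r := by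
    filter_upwards [isOpen_ball.mem_nhds (mem_ball_comm.1 hy)] with x' hx' using mem_ball_comm.1 hx'
  have hincr : ∀ᶠ x' in 𝓝 x, a < edist (w y) (w x') :=
    (continuous_const.edist hw).continuousAt.eventually_const_lt hay
  filter_upwards [hclose, hincr] with x' hx' hax'
  exact hax'.trans_le (le_iSup₂ (f := fun y (_ : y ∈ ball x' r) ↦ edist (w y) (w x')) y hx')

lemma localSlope_le {w : X → ℝ} {C : ℝ≥0} (hw : LipschitzWith C w) (r : ℝ) (x : X) :
    localSlope w r x ≤ C := by
  refine ENNReal.div_le_of_le_mul (iSup₂_le fun y hy ↦ (hw y x).trans ?_)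
  gcongr
  rw [edist_dist]
  exact ENNReal.ofReal_le_ofReal hy.le

namespace IsAlmostIsometric

variable {E : Type*} [NormedAddCommGroup E] [NormedSpace ℝ E] {P : E → X} {p : E → Seminorm ℝ E}
  {c : E} {R K : ℝ} (h : IsAlmostIsometric P p c R K) {w : X → ℝ} {f' : E →L[ℝ] ℝ} {b L : ℝ}
include h

lemma eventually_localSlope_le (hf' : HasFDerivAt (w ∘ P) f' c) (hL0 : 0 ≤ L)
    (hL : ∀ v, |f' v| ≤ L * p c v) (hb : L < b) :
    ∀ᶠ r in 𝓝[>] 0, localSlope w r (P c) ≤ ENNReal.ofReal b := by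
  have hK := zero_lt_one.trans_le h.one_le
  have hc := mem_ball_self h.radius_pos (x := c)
  obtain ⟨ε, hε, hεb⟩ : ∃ ε > 0, L + ε * (3 * K) < b :=
    ⟨(b - L) / (6 * K), div_pos (by linarith) (by positivity), by field_simp; linarith⟩
  obtain ⟨δ, hδ, hδε⟩ := Metric.eventually_nhds_iff_ball.1 (hf'.isLittleO.def hε)
  obtain ⟨σ, hσ, hball⟩ := h.exists_ball_subset
  have hcont : Continuous fun r ↦ L * (1 + K * (3 * K * r)) + ε * (3 * K) := by fun_prop
  have hlim := (hcont.tendsto' 0 (L + ε * (3 * K)) (by ring)).eventually_lt_const hεb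
  filter_upwards [hlim.filter_mono nhdsWithin_le_nhds,
    Ioo_mem_nhdsGT (lt_min hσ (show 0 < δ / (3 * K) by positivity))] with r hrb hr
  have hr0 : 0 ≤ r := hr.1.le
  refine ENNReal.div_le_of_le_mul (iSup₂_le fun y hy ↦ ?_)
  obtain ⟨z, hz, rfl⟩ := hball (ball_subset_ball (hr.2.le.trans (min_le_left _ _)) hy)
  have hdist : dist (P c) (P z) ≤ r := (mem_ball'.1 hy).le
  have hnorm : ‖z - c‖ ≤ 3 * K * r := (h.norm_sub_le_mul_dist hc hz).trans (by gcongr)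
  have hzδ : z ∈ ball c δ := by
    have hrδ := hr.2.trans_le (min_le_right _ _)
    rw [lt_div_iff₀' (by positivity)] at hrδ
    exact mem_ball_iff_norm.2 (hnorm.trans_lt hrδ)
  have hp : p c (z - c) ≤ (1 + K * (3 * K * r)) * r :=
    (h.le_dist hc hc hz (by rw [sub_self, norm_zero]; positivity) hnorm).trans (by gcongr)
  have hlin : |w (P z) - w (P c) - f' (z - c)| ≤ ε * ‖z - c‖ := hδε z hzδ
  have hincr : |w (P z) - w (P c)| ≤ b * r := by
    calc |w (P z) - w (P c)| ≤ |f' (z - c)| + ε * ‖z - c‖ := by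
          linarith [abs_sub_abs_le_abs_sub (w (P z) - w (P c)) (f' (z - c))]
      _ ≤ L * ((1 + K * (3 * K * r)) * r) + ε * (3 * K * r) := by
          gcongr
          exact (hL _).trans (by gcongr)
      _ = (L * (1 + K * (3 * K * r)) + ε * (3 * K)) * r := by ring
      _ ≤ b * r := by gcongr
  rw [edist_dist, ← ENNReal.ofReal_mul (hL0.trans hb.le), Real.dist_eq]
  exact ENNReal.ofReal_le_ofReal hincr

lemma eventually_le_localSlope (hf' : HasFDerivAt (w ∘ P) f' c) {v : E} (hv : p c v < 1)
    (hb0 : 0 ≤ b) (hb : b < f' v) :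
    ∀ᶠ r in 𝓝[>] 0, ENNReal.ofReal b ≤ localSlope w r (P c) := by
  have := h.one_le
  have hc := mem_ball_self h.radius_pos (x := c)
  have hincr : ∀ᶠ r in 𝓝[>] 0, b < r⁻¹ * (w (P (c + r • v)) - w (P c)) :=
    ((hf'.hasLineDerivAt v).tendsto_slope_zero_right.congr fun r ↦ by simp).eventually_const_lt hb
  have hdist : ∀ᶠ r in 𝓝 (0 : ℝ), (1 + K * ‖r • v‖) * p c v < 1 := by
    have hcont : Continuous fun r : ℝ ↦ (1 + K * ‖r • v‖) * p c v := by fun_prop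
    exact (hcont.tendsto' 0 (p c v) (by simp)).eventually_lt_const hv
  have hmem : ∀ᶠ r in 𝓝 (0 : ℝ), c + r • v ∈ ball c R := by
    have hcont : Continuous fun r : ℝ ↦ c + r • v := by fun_prop
    exact (hcont.tendsto' 0 c (by simp)).eventually (ball_mem_nhds _ h.radius_pos)
  filter_upwards [hincr, hdist.filter_mono nhdsWithin_le_nhds, hmem.filter_mono nhdsWithin_le_nhds,
    self_mem_nhdsWithin] with r hrb hrd hrR (hr : 0 < r)
  have hy : P (c + r • v) ∈ ball (P c) r := by
    rw [mem_ball']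
    calc dist (P c) (P (c + r • v)) ≤ (1 + K * ‖r • v‖) * p c (r • v) := by
          simpa using h.dist_le (ρ := ‖r • v‖) hc hc hrR (by simp) (by simp)
      _ = (1 + K * ‖r • v‖) * p c v * r := by
          rw [map_smul_eq_mul, Real.norm_of_nonneg hr.le]
          ring
      _ < r := mul_lt_of_lt_one_left hr hrd
  rw [localSlope, ENNReal.le_div_iff_mul_le (by simp [hr]) (by simp), ← ENNReal.ofReal_mul hb0]
  refine le_iSup₂_of_le _ hy ?_
  rw [edist_dist, Real.dist_eq]
  refine ENNReal.ofReal_le_ofReal (le_trans ?_ (le_abs_self _))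
  exact ((lt_inv_mul_iff₀' hr).1 hrb).le

lemma tendsto_localSlope (hf' : HasFDerivAt (w ∘ P) f' c) (hL : ∀ v, |f' v| ≤ L * p c v) {v : E}
    (hv : p c v ≤ 1) (hv' : f' v = L) :
    Tendsto (localSlope w · (P c)) (𝓝[>] 0) (𝓝 (ENNReal.ofReal L)) := by
  have hL0 : 0 ≤ L := by
    have hle := hL v
    rw [hv'] at hle
    nlinarith [abs_nonneg L, neg_abs_le L, apply_nonneg (p c) v]
  refine tendsto_order.2 ⟨fun a ha ↦ ?_, fun a ha ↦ ?_⟩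
  · obtain ⟨b, hab, hbL⟩ := exists_between ha
    have hb := hbL.trans ENNReal.ofReal_lt_top
    have hbL' : b.toReal < f' v := hv' ▸ ENNReal.toReal_lt_of_lt_ofReal hbL
    obtain ⟨θ, hθb, hθ0, hθ1⟩ : ∃ θ, b.toReal < θ * f' v ∧ 0 < θ ∧ θ < 1 := by
      have hlim := (continuous_mul_const (f' v)).tendsto' 1 (f' v) (one_mul _)
      exact (((hlim.eventually_const_lt hbL').filter_mono nhdsWithin_le_nhds).and
        (Ioo_mem_nhdsLT zero_lt_one)).exists
    have hθv : p c (θ • v) < 1 := by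
      rw [map_smul_eq_mul, Real.norm_of_nonneg hθ0.le]
      nlinarith
    filter_upwards [h.eventually_le_localSlope hf' hθv ENNReal.toReal_nonneg
      (by rwa [map_smul, smul_eq_mul])] with r hr
    rw [ENNReal.ofReal_toReal hb.ne] at hr
    exact hab.trans_le hr
  · obtain ⟨b, hLb, hba⟩ := exists_between ha
    have hb := hba.trans_le le_top
    have hLb' : L < b.toReal := (ENNReal.ofReal_lt_iff_lt_toReal hL0 hb.ne).1 hLb
    filter_upwards [h.eventually_localSlope_le hf' hL0 hL hLb'] with r hr
    rw [ENNReal.ofReal_toReal hb.ne] at hr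
    exact hr.trans_lt hba

end IsAlmostIsometric

end LocalSlope

section AlmostEverywhere

open scoped Pointwise in
lemma ae_uniqueDiffWithinAt {V : Type*} [NormedAddCommGroup V] [NormedSpace ℝ V]
    [FiniteDimensional ℝ V] [MeasurableSpace V] [BorelSpace V] (μ : Measure V)
    [μ.IsAddHaarMeasure] {s : Set V} (hs : MeasurableSet s) :
    ∀ᵐ x ∂μ, x ∈ s → UniqueDiffWithinAt ℝ s x := by
  rw [← ae_restrict_iff' hs]
  filter_upwards [Besicovitch.ae_tendsto_measure_inter_div μ s, ae_restrict_mem hs] with x hx hxs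
  suffices hcone : tangentConeAt ℝ s x = univ from ⟨by simp [hcone], subset_closure hxs⟩
  refine eq_univ_of_forall fun z ↦ ?_
  have happrox : ∀ k : ℕ, ∃ r : ℝ, ∃ a : V, 0 < r ∧ r < 1 / ((k : ℝ) + 1) ∧
      dist a z ≤ 1 / ((k : ℝ) + 1) ∧ x + r • a ∈ s := by
    intro k
    have hk : 0 < 1 / ((k : ℝ) + 1) := by positivity
    have hinter : ∀ᶠ r in 𝓝[>] (0 : ℝ),
        (s ∩ ({x} + r • closedBall z (1 / ((k : ℝ) + 1)))).Nonempty :=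
      Measure.eventually_nonempty_inter_smul_of_density_one μ s x hx _ measurableSet_closedBall
        (measure_closedBall_pos μ z hk).ne'
    obtain ⟨r, ⟨y, hys, hy⟩, hr⟩ := (hinter.and (Ioo_mem_nhdsGT hk)).exists
    rw [singleton_add] at hy
    obtain ⟨_, ⟨a, ha, rfl⟩, rfl⟩ := hy
    exact ⟨r, a, hr.1, hr.2, ha, hys⟩
  choose r a hr hr' ha has using happrox
  have hlim : Tendsto (fun k : ℕ ↦ 1 / ((k : ℝ) + 1)) atTop (𝓝 0) :=
    tendsto_one_div_add_atTop_nhds_zero_nat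
  have hr0 : Tendsto r atTop (𝓝 0) :=
    squeeze_zero (fun k ↦ (hr k).le) (fun k ↦ (hr' k).le) hlim
  have ha0 : Tendsto a atTop (𝓝 z) :=
    tendsto_iff_dist_tendsto_zero.2 (squeeze_zero (fun _ ↦ dist_nonneg) ha hlim)
  refine mem_tangentConeAt_of_seq atTop (fun k ↦ (r k)⁻¹) (fun k ↦ r k • a k) ?_
    (Eventually.of_forall has) (ha0.congr fun k ↦ (inv_smul_smul₀ (hr k).ne' _).symm)
  simpa using hr0.smul ha0

lemma iSup_measure_eq_zero {α : Type*} {ι : Sort*} [MeasurableSpace α] {μ : ι → Measure α}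
    {s : Set α} (hs : MeasurableSet s) (h : ∀ i, μ i s = 0) : (⨆ i, μ i) s = 0 := by
  have hle : (⨆ i, μ i) ≤ (⨆ i, μ i).restrict sᶜ := iSup_le fun i ↦
    calc μ i = (μ i).restrict sᶜ :=
          (Measure.restrict_eq_self_of_ae_mem (measure_eq_zero_iff_ae_notMem.1 (h i))).symm
      _ ≤ (⨆ i, μ i).restrict sᶜ := Measure.restrict_mono le_rfl (le_iSup μ i)
  simpa [Measure.restrict_apply hs] using hle s

lemma measurableSet_source_inter_preimage {α β : Type*} [TopologicalSpace α] [MeasurableSpace α]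
    [OpensMeasurableSpace α] [TopologicalSpace β] [MeasurableSpace β] [BorelSpace β]
    (e : OpenPartialHomeomorph α β) {T : Set β} (hT : MeasurableSet T) :
    MeasurableSet (e.source ∩ e ⁻¹' T) := by
  rw [← Subtype.image_preimage_coe, ← preimage_comp]
  exact e.open_source.measurableSet.subtype_image (e.continuousOn.domRestrict.measurable hT)

variable {n : ℕ} {N : Type*} [MetricSpace N] [ChartedSpace (EuclideanSpace ℝ (Fin n)) N]

lemma volume_target_inter_preimage_eq_zero
    {e c : OpenPartialHomeomorph N (EuclideanSpace ℝ (Fin n))}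
    (he : e.MDifferentiable (𝓡 n) (𝓡 n)) (hc : c.MDifferentiable (𝓡 n) (𝓡 n))
    {T : Set (EuclideanSpace ℝ (Fin n))} (hT : volume T = 0) :
    volume (e.target ∩ e.symm ⁻¹' (c.source ∩ c ⁻¹' T)) = 0 := by
  have hdiff : DifferentiableOn ℝ (e ∘ c.symm) (T ∩ (c.target ∩ c.symm ⁻¹' e.source)) :=
    (mdifferentiableOn_iff_differentiableOn.1
      (he.1.comp (hc.2.mono inter_subset_left) inter_subset_right)).mono inter_subset_right
  refine measure_mono_null ?_ (addHaar_image_eq_zero_of_differentiableOn_of_addHaar_eq_zero volume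
    hdiff (measure_mono_null inter_subset_left hT))
  rintro z ⟨hze, hzc, hzT⟩
  refine ⟨c (e.symm z), ⟨hzT, c.map_source hzc, ?_⟩, ?_⟩
  · rw [mem_preimage, c.left_inv hzc]
    exact e.map_target hze
  · rw [Function.comp_apply, c.left_inv hzc, e.right_inv hze]

variable [IsManifold (𝓡 n) 1 N] [RiemannianBundle (fun x : N ↦ TangentSpace (𝓡 n) x)]
  [MeasurableSpace N] [BorelSpace N] {m : Measure N}

lemma measure_source_inter_preimage_eq_zero (hac : m ≪ riemannianVolume n N)
    {c : OpenPartialHomeomorph N (EuclideanSpace ℝ (Fin n))}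
    (hc : c ∈ atlas (EuclideanSpace ℝ (Fin n)) N) {T : Set (EuclideanSpace ℝ (Fin n))}
    (hT : volume T = 0) : m (c.source ∩ c ⁻¹' T) = 0 := by
  have hT' : volume (toMeasurable volume T) = 0 := by rwa [measure_toMeasurable]
  have hmeas := measurableSet_source_inter_preimage c (measurableSet_toMeasurable volume T)
  refine measure_mono_null (inter_subset_inter_right _
    (preimage_mono (subset_toMeasurable volume T))) (hac ?_)
  refine iSup_measure_eq_zero hmeas fun e ↦ iSup_measure_eq_zero hmeas fun he ↦ ?_
  have hdensity := withDensity_absolutelyContinuous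
    ((volume : Measure (EuclideanSpace ℝ (Fin n))).restrict e.target)
    fun y ↦ ENNReal.ofReal (√(metricMatrix e y).det)
  have hsymm : AEMeasurable e.symm
      ((volume : Measure (EuclideanSpace ℝ (Fin n))).restrict e.target) :=
    e.symm.continuousOn.aemeasurable e.open_target.measurableSet
  rw [chartVolume, Measure.map_apply_of_aemeasurable (hsymm.mono_ac hdensity) hmeas]
  refine hdensity ?_
  rw [Measure.restrict_apply₀' e.open_target.measurableSet.nullMeasurableSet, inter_comm]
  exact volume_target_inter_preimage_eq_zero (mdifferentiable_of_mem_atlas he)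
    (mdifferentiable_of_mem_atlas hc) hT'

variable {M : Set N}

lemma ae_restrict_of_forall_ae_extChartAt (hM : IsCompact M) (hac : m ≪ riemannianVolume n N)
    {q : N → Prop} (h : ∀ x₀ : N, ∃ s ∈ 𝓝 (extChartAt (𝓡 n) x₀ x₀), ∀ᵐ z, z ∈ s →
      (extChartAt (𝓡 n) x₀).symm z ∈ M → q ((extChartAt (𝓡 n) x₀).symm z)) :
    ∀ᵐ x ∂m.restrict M, q x := by
  rw [ae_restrict_iff' hM.measurableSet, ae_iff]
  simp only [Classical.not_imp]
  refine hM.induction_on (p := fun t ↦ m {x | x ∈ t ∧ ¬q x} = 0) (by simp)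
    (fun s t hst ht ↦ measure_mono_null ?_ ht)
    (fun s t hs ht ↦ measure_mono_null ?_ (measure_union_null hs ht)) fun x₀ _ ↦ ?_
  · exact fun x hx ↦ ⟨hst hx.1, hx.2⟩
  · exact fun x hx ↦ hx.1.imp (And.intro · hx.2) (And.intro · hx.2)
  obtain ⟨s, hs, hq⟩ := h x₀
  refine ⟨M ∩ ((extChartAt (𝓡 n) x₀).source ∩ extChartAt (𝓡 n) x₀ ⁻¹' s),
    inter_mem self_mem_nhdsWithin (mem_nhdsWithin_of_mem_nhds (inter_mem
      (extChartAt_source_mem_nhds x₀) ((continuousAt_extChartAt x₀).preimage_mem_nhds hs))), ?_⟩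
  refine measure_mono_null ?_ (measure_source_inter_preimage_eq_zero hac
    (chart_mem_atlas _ x₀) (ae_iff.1 hq))
  rintro x ⟨⟨hxM, hxe, hxs⟩, hxq⟩
  have hx := (extChartAt (𝓡 n) x₀).left_inv hxe
  refine ⟨by simpa using hxe, fun hall ↦ hxq ?_⟩
  rw [← hx]
  exact hall hxs (hx.symm ▸ hxM)

lemma ae_uniqueMDiffWithinAt (hM : IsCompact M) (hac : m ≪ riemannianVolume n N) :
    ∀ᵐ x ∂m.restrict M, UniqueMDiffWithinAt (𝓡 n) M x := by
  refine ae_restrict_of_forall_ae_extChartAt hM hac fun x₀ ↦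
    ⟨(extChartAt (𝓡 n) x₀).target, extChartAt_target_mem_nhds x₀, ?_⟩
  filter_upwards [ae_uniqueDiffWithinAt volume (measurableSet_source_inter_preimage
    (chartAt (EuclideanSpace ℝ (Fin n)) x₀).symm hM.measurableSet)] with z hz hzc hzM
  simp only [mfld_simps] at hzc hzM hz ⊢
  have huniq := uniqueMDiffWithinAt_iff_uniqueDiffWithinAt.2 (hz hzc hzM)
  refine (huniq.preimage_openPartialHomeomorph (mdifferentiable_chart (I := 𝓡 n) x₀).symm
    hzc).mono ?_
  rintro y ⟨hy, -, hyM⟩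
  have hinv := (chartAt (EuclideanSpace ℝ (Fin n)) x₀).left_inv hy
  rw [mem_preimage, OpenPartialHomeomorph.symm_symm, hinv] at hyM
  exact hyM

variable [IsContMDiffRiemannianBundle (𝓡 n) 1 (EuclideanSpace ℝ (Fin n))
  (fun x : N ↦ TangentSpace (𝓡 n) x)] [IsRiemannianManifold (𝓡 n) N]

lemma ae_mdifferentiableAt (hM : IsCompact M) (hac : m ≪ riemannianVolume n N) {w : N → ℝ}
    (hw : LocallyLipschitz w) : ∀ᵐ x ∂m.restrict M, MDifferentiableAt (𝓡 n) 𝓘(ℝ, ℝ) w x := by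
  refine ae_restrict_of_forall_ae_extChartAt hM hac fun x₀ ↦ ?_
  obtain ⟨R, K, h⟩ := exists_chartBound (E := EuclideanSpace ℝ (Fin n)) x₀
  have hP : LipschitzOnWith K.toNNReal (extChartAt (𝓡 n) x₀).symm
      (ball (extChartAt (𝓡 n) x₀ x₀) R) :=
    LipschitzOnWith.of_dist_le' fun z hz z' hz' ↦ by
      rw [dist_eq_norm']
      exact h.dist_le_mul_norm hz hz'
  obtain ⟨C, t, ht, hCt⟩ := hw x₀
  have hpre : (extChartAt (𝓡 n) x₀).symm ⁻¹' t ∈ 𝓝 (extChartAt (𝓡 n) x₀ x₀) :=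
    (continuousAt_extChartAt_symm x₀).preimage_mem_nhds (by rwa [extChartAt_to_inv])
  obtain ⟨r, hr, hrt⟩ := Metric.mem_nhds_iff.1
    (inter_mem (ball_mem_nhds _ h.radius_pos) hpre)
  have hlip : LipschitzOnWith (C * K.toNNReal) (w ∘ (extChartAt (𝓡 n) x₀).symm)
      (ball (extChartAt (𝓡 n) x₀ x₀) r) :=
    hCt.comp (hP.mono fun z hz ↦ (hrt hz).1) fun z hz ↦ (hrt hz).2
  refine ⟨_, ball_mem_nhds _ hr, ?_⟩
  filter_upwards [hlip.ae_differentiableWithinAt_of_mem (μ := volume)] with z hz hzr _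
  have hztgt := h.ball_subset (hrt hzr).1
  have hzsrc := (extChartAt (𝓡 n) x₀).map_target hztgt
  have hdiff := (hz hzr).differentiableAt (isOpen_ball.mem_nhds hzr)
  rw [← (extChartAt (𝓡 n) x₀).right_inv hztgt] at hdiff
  refine (hdiff.mdifferentiableAt.comp _ (mdifferentiableAt_extChartAt
    (by simpa using hzsrc))).congr_of_eventuallyEq ?_
  filter_upwards [(isOpen_extChartAt_source x₀).mem_nhds hzsrc] with y hy
  simp only [Function.comp_apply, (extChartAt (𝓡 n) x₀).left_inv hy]

end AlmostEverywhere

section Integral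

variable {α : Type*} [MeasurableSpace α] {μ : Measure α} [IsFiniteMeasure μ]

lemma lintegral_sq_lt_top_of_ae_le {C : ℝ≥0} {f : α → ℝ≥0∞} (h : ∀ᵐ x ∂μ, f x ≤ C) :
    ∫⁻ x, f x ^ 2 ∂μ < ⊤ := by
  calc ∫⁻ x, f x ^ 2 ∂μ ≤ ∫⁻ _, (C : ℝ≥0∞) ^ 2 ∂μ :=
        lintegral_mono_ae (h.mono fun x hx ↦ pow_le_pow_left' hx 2)
    _ < ⊤ := by
      rw [lintegral_const]
      finiteness

lemma tendsto_lintegral_sq_zero {ι : Type*} {l : Filter ι} [l.IsCountablyGenerated]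
    {f : ι → α → ℝ≥0∞} {C : ℝ≥0} (hf : ∀ i, AEMeasurable (f i) μ)
    (hC : ∀ᶠ i in l, ∀ᵐ x ∂μ, f i x ≤ C) (hlim : ∀ᵐ x ∂μ, Tendsto (f · x) l (𝓝 0)) :
    Tendsto (fun i ↦ ∫⁻ x, f i x ^ 2 ∂μ) l (𝓝 0) := by
  have := tendsto_lintegral_filter_of_dominated_convergence' (F := fun i x ↦ f i x ^ 2)
    (f := fun _ ↦ 0) (fun _ ↦ (C : ℝ≥0∞) ^ 2)
    (Eventually.of_forall fun i ↦ (hf i).pow_const 2)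
    (hC.mono fun i hi ↦ hi.mono fun x hx ↦ pow_le_pow_left' hx 2)
    (by rw [lintegral_const]; finiteness)
    (hlim.mono fun x hx ↦ by simpa using ENNReal.Tendsto.pow (n := 2) hx)
  simpa only [lintegral_zero] using this

end Integral

section Gradient

variable {n : ℕ} {N : Type*} {M : Set N} {u : M → ℝ} {w : N → ℝ} {x : N}

lemma extendZero_of_mem (u : M → ℝ) (hx : x ∈ M) : extendZero M u x = u ⟨x, hx⟩ :=
  Subtype.val_injective.extend_apply u 0 ⟨x, hx⟩

variable [MetricSpace N] {C : ℝ≥0}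

lemma exists_lipschitzWith_extension {C : ℝ≥0} (hu : LipschitzWith C u) :
    ∃ w : N → ℝ, LipschitzWith C w ∧ ∀ x : M, w x = u x := by
  have hext : LipschitzOnWith C (extendZero M u) M := by
    refine lipschitzOnWith_iff_restrict.2 fun x y ↦ ?_
    simpa [extendZero_of_mem] using hu x y
  obtain ⟨w, hw, heq⟩ := hext.extend_real
  exact ⟨w, hw, fun x ↦ by rw [← heq x.2, extendZero_of_mem u x.2]⟩

variable [ChartedSpace (EuclideanSpace ℝ (Fin n)) N]
  [RiemannianBundle (fun x : N ↦ TangentSpace (𝓡 n) x)]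

lemma hasGradAt_iff (hwu : ∀ x : M, w x = u x) (hx : x ∈ M) {v : TangentSpace (𝓡 n) x} :
    HasGradAt n M u x v ↔ HasMFDerivWithinAt (𝓡 n) 𝓘(ℝ, ℝ) w M x (innerSL ℝ v) := by
  have heq : EqOn w (extendZero M u) M := fun y hy ↦ by rw [extendZero_of_mem u hy, ← hwu ⟨y, hy⟩]
  exact ⟨fun h ↦ h.congr_mono heq (heq hx) subset_rfl,
    fun h ↦ h.congr_mono heq.symm (heq hx).symm subset_rfl⟩

lemma exists_hasMFDerivAt_innerSL (h : MDifferentiableAt (𝓡 n) 𝓘(ℝ, ℝ) w x) :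
    ∃ v : TangentSpace (𝓡 n) x, HasMFDerivAt (𝓡 n) 𝓘(ℝ, ℝ) w x (innerSL ℝ v) := by
  have : FiniteDimensional ℝ (TangentSpace (𝓡 n) x) :=
    inferInstanceAs (FiniteDimensional ℝ (EuclideanSpace ℝ (Fin n)))
  have : CompleteSpace (TangentSpace (𝓡 n) x) := FiniteDimensional.complete ℝ _
  let ℓ : TangentSpace (𝓡 n) x →L[ℝ] ℝ := mfderiv (𝓡 n) 𝓘(ℝ, ℝ) w x
  have hℓ : innerSL ℝ ((InnerProductSpace.toDual ℝ (TangentSpace (𝓡 n) x)).symm ℓ) = ℓ :=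
    (InnerProductSpace.toDual ℝ (TangentSpace (𝓡 n) x)).apply_symm_apply ℓ
  refine ⟨(InnerProductSpace.toDual ℝ (TangentSpace (𝓡 n) x)).symm ℓ, ?_⟩
  rw [hℓ]
  exact h.hasMFDerivAt

lemma hasGradAt_grad (h : ∃ v, HasGradAt n M u x v) : HasGradAt n M u x (grad n M u x) := by
  rw [grad, dif_pos h]
  exact h.choose_spec

lemma hasMFDerivAt_grad (hwu : ∀ x : M, w x = u x) (hx : x ∈ M)
    (hM : UniqueMDiffWithinAt (𝓡 n) M x) (hw : MDifferentiableAt (𝓡 n) 𝓘(ℝ, ℝ) w x) :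
    HasMFDerivAt (𝓡 n) 𝓘(ℝ, ℝ) w x (innerSL ℝ (grad n M u x)) := by
  obtain ⟨v, hv⟩ := exists_hasMFDerivAt_innerSL hw
  have hgrad := (hasGradAt_iff hwu hx).1
    (hasGradAt_grad ⟨v, (hasGradAt_iff hwu hx).2 hv.hasMFDerivWithinAt⟩)
  have heq := hM.eq hgrad hv.hasMFDerivWithinAt
  rwa [heq]

lemma exists_hasFDerivAt_comp_extChartAt_symm {v : TangentSpace (𝓡 n) x}
    (h : HasMFDerivAt (𝓡 n) 𝓘(ℝ, ℝ) w x (innerSL ℝ v)) :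
    ∃ f' : EuclideanSpace ℝ (Fin n) →L[ℝ] ℝ,
      HasFDerivAt (w ∘ (extChartAt (𝓡 n) x).symm) f' (extChartAt (𝓡 n) x x) ∧
      ∀ y : TangentSpace (𝓡 n) x, f' (y : EuclideanSpace ℝ (Fin n)) = inner ℝ v y := by
  refine ⟨(innerSL ℝ v : TangentSpace (𝓡 n) x →L[ℝ] ℝ), ?_, fun y ↦ rfl⟩
  have := h.2
  rw [modelWithCornersSelf_coe, range_id] at this
  exact hasFDerivWithinAt_univ.1 this

variable [IsManifold (𝓡 n) 1 N] [IsContMDiffRiemannianBundle (𝓡 n) 1 (EuclideanSpace ℝ (Fin n))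
  (fun x : N ↦ TangentSpace (𝓡 n) x)] [IsRiemannianManifold (𝓡 n) N]

lemma tendsto_localSlope {v : TangentSpace (𝓡 n) x}
    (h : HasMFDerivAt (𝓡 n) 𝓘(ℝ, ℝ) w x (innerSL ℝ v)) :
    Tendsto (localSlope w · x) (𝓝[>] 0) (𝓝 ‖v‖ₑ) := by
  obtain ⟨R, K, hRK⟩ := exists_chartBound (E := EuclideanSpace ℝ (Fin n)) x
  obtain ⟨R', K', hP⟩ := hRK.exists_isAlmostIsometric
  obtain ⟨f', hf', hfv⟩ := exists_hasFDerivAt_comp_extChartAt_symm h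
  have hle : ∀ y : TangentSpace (𝓡 n) x, |f' y| ≤ ‖v‖ * chartNorm x (extChartAt (𝓡 n) x x) y := by
    intro y
    rw [hfv, chartNorm_self]
    exact abs_real_inner_le_norm v y
  have hunit : chartNorm x (extChartAt (𝓡 n) x x)
      ((‖v‖⁻¹ • v : TangentSpace (𝓡 n) x) : EuclideanSpace ℝ (Fin n)) ≤ 1 := by
    rw [chartNorm_self, norm_smul, norm_inv, norm_norm]
    exact inv_mul_le_one
  have hval : f' ((‖v‖⁻¹ • v : TangentSpace (𝓡 n) x) : EuclideanSpace ℝ (Fin n)) = ‖v‖ := by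
    rw [hfv, real_inner_smul_right, real_inner_self_eq_norm_sq]
    obtain hv | hv := eq_or_ne ‖v‖ 0
    · simp [hv]
    · field_simp
  have := hP.tendsto_localSlope hf' hle hunit hval
  rwa [extChartAt_to_inv, ofReal_norm] at this

variable [MeasurableSpace N] [BorelSpace N] {m : Measure N}

lemma ae_hasMFDerivAt_grad (hM : IsCompact M) (hac : m ≪ riemannianVolume n N)
    (hw : LocallyLipschitz w) (hwu : ∀ x : M, w x = u x) :
    ∀ᵐ x ∂m.restrict M, HasMFDerivAt (𝓡 n) 𝓘(ℝ, ℝ) w x (innerSL ℝ (grad n M u x)) := by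
  filter_upwards [ae_restrict_mem hM.measurableSet, ae_uniqueMDiffWithinAt hM hac,
    ae_mdifferentiableAt hM hac hw] with x hx huniq hdiff
  exact hasMFDerivAt_grad hwu hx huniq hdiff

lemma ae_hasGradAt_grad (hM : IsCompact M) (hac : m ≪ riemannianVolume n N)
    (hu : LipschitzWith C u) : ∀ᵐ x ∂m.restrict M, HasGradAt n M u x (grad n M u x) := by
  obtain ⟨w, hw, hwu⟩ := exists_lipschitzWith_extension hu
  filter_upwards [ae_restrict_mem hM.measurableSet,
    ae_hasMFDerivAt_grad hM hac hw.locallyLipschitz hwu] with x hx hgrad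
  exact (hasGradAt_iff hwu hx).2 hgrad.hasMFDerivWithinAt

lemma ae_enorm_grad_le (hM : IsCompact M) (hac : m ≪ riemannianVolume n N)
    (hu : LipschitzWith C u) : ∀ᵐ x ∂m.restrict M, ‖grad n M u x‖ₑ ≤ C := by
  obtain ⟨w, hw, hwu⟩ := exists_lipschitzWith_extension hu
  filter_upwards [ae_hasMFDerivAt_grad hM hac hw.locallyLipschitz hwu] with x hx
  exact le_of_tendsto (tendsto_localSlope hx) (Eventually.of_forall (localSlope_le hw · x))

lemma aemeasurable_enorm_grad (hM : IsCompact M) (hac : m ≪ riemannianVolume n N)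
    (hu : LipschitzWith C u) : AEMeasurable (fun x ↦ ‖grad n M u x‖ₑ) (m.restrict M) := by
  obtain ⟨w, hw, hwu⟩ := exists_lipschitzWith_extension hu
  obtain ⟨r, hr⟩ := exists_seq_tendsto (𝓝[>] (0 : ℝ))
  refine aemeasurable_of_tendsto_metrizable_ae'
    (fun k ↦ (measurable_localSlope hw.continuous (r k)).aemeasurable) ?_
  filter_upwards [ae_hasMFDerivAt_grad hM hac hw.locallyLipschitz hwu] with x hx
  exact (tendsto_localSlope hx).comp hr

lemma isLipschitzH1_of_lipschitzWith [IsFiniteMeasureOnCompacts m] (hM : IsCompact M)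
    (hac : m ≪ riemannianVolume n N) (hu : LipschitzWith C u) : IsLipschitzH1 n m M u := by
  have : IsFiniteMeasure (m.restrict M) := isFiniteMeasure_restrict.2 hM.measure_ne_top
  have : CompactSpace M := isCompact_iff_compactSpace.1 hM
  obtain ⟨A, hA⟩ := isCompact_univ.exists_bound_of_continuousOn hu.continuous.continuousOn
  have hbound : ∀ᵐ x ∂m.restrict M, ‖extendZero M u x‖ₑ ≤ (A.toNNReal : ℝ≥0∞) := by
    filter_upwards [ae_restrict_mem hM.measurableSet] with x hx
    rw [extendZero_of_mem u hx, ← ofReal_norm]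
    exact ENNReal.ofReal_le_ofReal (hA _ (mem_univ _))
  refine ⟨⟨C, hu⟩, (ae_hasGradAt_grad hM hac hu).mono fun x hx ↦ ⟨_, hx⟩,
    aemeasurable_enorm_grad hM hac hu, ?_⟩
  exact ENNReal.rpow_lt_top_of_nonneg (by norm_num) (ENNReal.add_lt_top.2
    ⟨lintegral_sq_lt_top_of_ae_le (ae_enorm_grad_le hM hac hu),
      lintegral_sq_lt_top_of_ae_le hbound⟩).ne

end Gradient

section Convergence

variable {n : ℕ} {N : Type*} {M : Set N} {ι : Type*} {l : Filter ι} [MetricSpace N]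
  [ChartedSpace (EuclideanSpace ℝ (Fin n)) N]
  [RiemannianBundle (fun x : N ↦ TangentSpace (𝓡 n) x)]
  {C : ℝ≥0}

section H1Norm

variable [MeasurableSpace N] [OpensMeasurableSpace N] {m : Measure N}

lemma mul_measure_ball_le_h1Norm_sq (hM : MeasurableSet M) {w : M → ℝ} (hw : LipschitzWith C w)
    (x : M) (r : ℝ) :
    ENNReal.ofReal (|w x| - C * r) ^ 2 * m.restrict M (ball (x : N) r) ≤ h1Norm n m M w ^ 2 := by
  have hle : ∀ᵐ y ∂(m.restrict M).restrict (ball (x : N) r),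
      ENNReal.ofReal (|w x| - C * r) ^ 2 ≤ ‖extendZero M w y‖ₑ ^ 2 := by
    filter_upwards [ae_restrict_mem measurableSet_ball, ae_restrict_of_ae (ae_restrict_mem hM)]
      with y hy hyM
    rw [extendZero_of_mem w hyM, ← ofReal_norm]
    gcongr
    have hdist : dist (w x) (w ⟨y, hyM⟩) ≤ C * r := (hw.dist_le_mul _ _).trans <|
      mul_le_mul_of_nonneg_left (mem_ball'.1 hy).le C.2
    rw [Real.dist_eq] at hdist
    rw [Real.norm_eq_abs]
    linarith [abs_sub_abs_le_abs_sub (w x) (w ⟨y, hyM⟩)]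
  calc ENNReal.ofReal (|w x| - C * r) ^ 2 * m.restrict M (ball (x : N) r)
      = ∫⁻ _ in ball (x : N) r, ENNReal.ofReal (|w x| - C * r) ^ 2 ∂m.restrict M :=
        (setLIntegral_const _ _).symm
    _ ≤ ∫⁻ y in ball (x : N) r, ‖extendZero M w y‖ₑ ^ 2 ∂m.restrict M := lintegral_mono_ae hle
    _ ≤ ∫⁻ y in M, ‖extendZero M w y‖ₑ ^ 2 ∂m := setLIntegral_le_lintegral _ _
    _ ≤ h1Norm n m M w ^ 2 := by
      rw [h1Norm, ← ENNReal.rpow_natCast, ← ENNReal.rpow_mul]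
      norm_num

variable {u : ι → M → ℝ}

lemma tendsto_apply_of_tendsto_h1Norm (hM : MeasurableSet M) (hu : ∀ i, LipschitzWith C (u i))
    (hlim : Tendsto (fun i ↦ h1Norm n m M (u i)) l (𝓝 0)) {x : M}
    (hx : (x : N) ∈ (m.restrict M).support) : Tendsto (u · x) l (𝓝 0) := by
  refine Metric.tendsto_nhds.2 fun ε hε ↦ ?_
  obtain ⟨r, hr, hCr⟩ : ∃ r > 0, C * r ≤ ε / 2 :=
    ⟨ε / (2 * (C + 1)), by positivity, by field_simp; linarith⟩
  have hball : 0 < m.restrict M (ball (x : N) r) :=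
    (Measure.mem_support_iff_forall _).1 hx _ (ball_mem_nhds _ hr)
  have hpos : 0 < ENNReal.ofReal (ε / 2) ^ 2 * m.restrict M (ball (x : N) r) :=
    ENNReal.mul_pos (pow_ne_zero 2 (ENNReal.ofReal_pos.2 (half_pos hε)).ne') hball.ne'
  have hsq : Tendsto (fun i ↦ h1Norm n m M (u i) ^ 2) l (𝓝 0) := by
    simpa using ENNReal.Tendsto.pow (n := 2) hlim
  filter_upwards [hsq.eventually_lt_const hpos] with i hi
  rw [Real.dist_0_eq_abs]
  by_contra! hge
  refine hi.not_ge (le_trans ?_ (mul_measure_ball_le_h1Norm_sq hM (hu i) x r))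
  gcongr
  linarith

lemma tendstoUniformly_of_tendsto_h1Norm (hM : IsCompact M) (hsupp : M ⊆ (m.restrict M).support)
    (hu : ∀ i, LipschitzWith C (u i)) (hlim : Tendsto (fun i ↦ h1Norm n m M (u i)) l (𝓝 0)) :
    TendstoUniformly u 0 l := by
  have : CompactSpace M := isCompact_iff_compactSpace.1 hM
  have hequi : Equicontinuous u := (LipschitzWith.uniformEquicontinuous u C hu).equicontinuous
  refine UniformFun.tendsto_iff_tendstoUniformly.1
    ((hequi.tendsto_uniformFun_iff_pi l (0 : M → ℝ)).2 (tendsto_pi_nhds.2 fun x ↦ ?_))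
  exact tendsto_apply_of_tendsto_h1Norm hM.measurableSet hu hlim (hsupp x.2)

end H1Norm

variable [IsManifold (𝓡 n) 1 N] {x : N}

lemma ChartBound.norm_le_mul_norm_of_inner_eq {R K : ℝ}
    (h : ChartBound (E := EuclideanSpace ℝ (Fin n)) x R K) {v : TangentSpace (𝓡 n) x}
    {f' : EuclideanSpace ℝ (Fin n) →L[ℝ] ℝ}
    (hf' : ∀ y : TangentSpace (𝓡 n) x, f' (y : EuclideanSpace ℝ (Fin n)) = inner ℝ v y) :
    ‖v‖ ≤ K * ‖f'‖ := by
  obtain hv | hv := (norm_nonneg v).eq_or_lt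
  · rw [← hv]
    exact mul_nonneg (zero_le_one.trans h.one_le) (norm_nonneg f')
  refine le_of_mul_le_mul_right ?_ hv
  let v' : EuclideanSpace ℝ (Fin n) := v
  have hv' : ‖v'‖ ≤ K * ‖v‖ := by
    rw [← chartNorm_self]
    exact h.le_chartNorm _ (mem_ball_self h.radius_pos) v'
  calc ‖v‖ * ‖v‖ = f' v' := by rw [← real_inner_self_eq_norm_mul_norm]; exact (hf' v).symm
    _ ≤ ‖f'‖ * ‖v'‖ := (le_abs_self _).trans (f'.le_opNorm v')
    _ ≤ ‖f'‖ * (K * ‖v‖) := by gcongr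
    _ = K * ‖f'‖ * ‖v‖ := by ring

variable [IsContMDiffRiemannianBundle (𝓡 n) 1 (EuclideanSpace ℝ (Fin n))
  (fun x : N ↦ TangentSpace (𝓡 n) x)] [IsRiemannianManifold (𝓡 n) N]

lemma tendsto_of_hasMFDerivAt_neg_hopfLax [Nonempty M] (hM : Bornology.IsBounded M)
    {u : ι → M → ℝ} {v : M → ℝ} (hu : ∀ i, BddBelow (range (u i))) (hv : BddBelow (range v))
    (hlim : TendstoUniformly u v l) {a : ι → TangentSpace (𝓡 n) x} {b : TangentSpace (𝓡 n) x}
    (ha : ∀ i, HasMFDerivAt (𝓡 n) 𝓘(ℝ, ℝ) (-hopfLax M (u i)) x (innerSL ℝ (a i)))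
    (hb : HasMFDerivAt (𝓡 n) 𝓘(ℝ, ℝ) (-hopfLax M v) x (innerSL ℝ b)) :
    Tendsto a l (𝓝 b) := by
  obtain ⟨R, K, hRK⟩ := exists_chartBound (E := EuclideanSpace ℝ (Fin n)) x
  obtain ⟨R', K', hP⟩ := hRK.exists_isAlmostIsometric
  obtain ⟨r, hr, C, hC⟩ := hP.exists_semiconcaveOn_hopfLax
    (hasAlmostIntermediatePoints_of_isRiemannianManifold (𝓡 n) N) hM
  choose f' hf' hfa using fun i ↦ exists_hasFDerivAt_comp_extChartAt_symm (ha i)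
  obtain ⟨g', hg', hgb⟩ := exists_hasFDerivAt_comp_extChartAt_symm hb
  have hunif : TendstoUniformlyOn (fun i ↦ hopfLax M (u i) ∘ (extChartAt (𝓡 n) x).symm)
      (hopfLax M v ∘ (extChartAt (𝓡 n) x).symm) l (ball (extChartAt (𝓡 n) x x) r) :=
    ((tendstoUniformly_hopfLax hu hv hlim).comp _).tendstoUniformlyOn
  have hneg : Tendsto (fun i ↦ -f' i) l (𝓝 (-g')) :=
    tendsto_fderiv_of_semiconcaveOn hr (by norm_num) (fun i ↦ hC _ (hu i)) hunif
      (fun i ↦ by simpa only [Pi.neg_comp, neg_neg] using (hf' i).neg)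
      (by simpa only [Pi.neg_comp, neg_neg] using hg'.neg)
  rw [tendsto_iff_norm_sub_tendsto_zero]
  refine squeeze_zero (fun _ ↦ norm_nonneg _) (fun i ↦ hRK.norm_le_mul_norm_of_inner_eq
    (f' := f' i - g') fun y ↦ ?_) ?_
  · exact (congr_arg₂ (· - ·) (hfa i y) (hgb y)).trans (inner_sub_left _ _ _).symm
  · have hf'g' : Tendsto f' l (𝓝 g') := by simpa using hneg.neg
    simpa using (tendsto_iff_norm_sub_tendsto_zero.1 hf'g').const_mul K

variable [MeasurableSpace N] [BorelSpace N] {m : Measure N}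

lemma ae_grad_sub (hM : IsCompact M) (hac : m ≪ riemannianVolume n N) {u v : M → ℝ} {D : ℝ≥0}
    (hu : LipschitzWith C u) (hv : LipschitzWith D v) :
    ∀ᵐ x ∂m.restrict M, grad n M (u - v) x = grad n M u x - grad n M v x := by
  obtain ⟨w, hw, hwu⟩ := exists_lipschitzWith_extension hu
  obtain ⟨z, hz, hzv⟩ := exists_lipschitzWith_extension hv
  filter_upwards [ae_hasMFDerivAt_grad hM hac hw.locallyLipschitz hwu,
    ae_hasMFDerivAt_grad hM hac hz.locallyLipschitz hzv,
    ae_hasMFDerivAt_grad hM hac (hw.sub hz).locallyLipschitz (u := u - v) fun x ↦ by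
      simp [hwu, hzv]] with x hwx hzx hsub
  refine innerSL_inj.1 ((hasMFDerivAt_unique hsub (hwx.sub hzx)).trans ?_)
  exact (map_sub (innerSL ℝ) _ _).symm

lemma ae_tendsto_grad_conj [Countable ι] (hM : IsCompact M) (hac : m ≪ riemannianVolume n N)
    {u : ι → M → ℝ} {v : M → ℝ} (hu : ∀ i, BddBelow (range (u i))) (hv : BddBelow (range v))
    (hlim : TendstoUniformly u v l) :
    ∀ᵐ x ∂m.restrict M, Tendsto (fun i ↦ grad n M (conj M (u i)) x) l
      (𝓝 (grad n M (conj M v) x)) := by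
  have hgrad : ∀ w : M → ℝ, BddBelow (range w) → ∀ᵐ x ∂m.restrict M,
      HasMFDerivAt (𝓡 n) 𝓘(ℝ, ℝ) (-hopfLax M w) x (innerSL ℝ (grad n M (conj M w) x)) :=
    fun w hw ↦ ae_hasMFDerivAt_grad hM hac (locallyLipschitz_hopfLax hM.isBounded hw).neg
      fun _ ↦ rfl
  filter_upwards [ae_restrict_mem hM.measurableSet, ae_all_iff.2 fun i ↦ hgrad (u i) (hu i),
    hgrad v hv] with x hx hux hvx
  have : Nonempty M := ⟨⟨x, hx⟩⟩
  exact tendsto_of_hasMFDerivAt_neg_hopfLax hM.isBounded hu hv hlim hux hvx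

lemma tendsto_h1Norm [l.IsCountablyGenerated] [IsFiniteMeasureOnCompacts m] (hM : IsCompact M)
    (hac : m ≪ riemannianVolume n N) {u : ι → M → ℝ} (hu : ∀ i, LipschitzWith C (u i))
    (hlim : TendstoUniformly u 0 l)
    (hgrad : ∀ᵐ x ∂m.restrict M, Tendsto (fun i ↦ grad n M (u i) x) l (𝓝 0)) :
    Tendsto (fun i ↦ h1Norm n m M (u i)) l (𝓝 0) := by
  have : IsFiniteMeasure (m.restrict M) := isFiniteMeasure_restrict.2 hM.measure_ne_top
  have hgradlim : Tendsto (fun i ↦ ∫⁻ x in M, ‖grad n M (u i) x‖ₑ ^ 2 ∂m) l (𝓝 0) := by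
    refine tendsto_lintegral_sq_zero (fun i ↦ aemeasurable_enorm_grad hM hac (hu i))
      (Eventually.of_forall fun i ↦ ae_enorm_grad_le hM hac (hu i)) ?_
    filter_upwards [hgrad] with x hx
    simpa using hx.enorm
  have hmeas : ∀ i, Measurable (extendZero M (u i)) := fun i ↦
    (MeasurableEmbedding.subtype_coe hM.measurableSet).measurable_extend
      (hu i).continuous.measurable measurable_const
  have hvalue : Tendsto (fun i ↦ ∫⁻ x in M, ‖extendZero M (u i) x‖ₑ ^ 2 ∂m) l (𝓝 0) := by
    refine tendsto_lintegral_sq_zero (C := 1) (fun i ↦ (hmeas i).enorm.aemeasurable) ?_ ?_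
    · filter_upwards [Metric.tendstoUniformly_iff.1 hlim 1 one_pos] with i hi
      filter_upwards [ae_restrict_mem hM.measurableSet] with x hx
      have := (hi ⟨x, hx⟩).le
      rw [Pi.zero_apply, dist_zero_left] at this
      rw [extendZero_of_mem _ hx, ← ofReal_norm]
      simpa using ENNReal.ofReal_le_ofReal this
    · filter_upwards [ae_restrict_mem hM.measurableSet] with x hx
      simp only [extendZero_of_mem _ hx]
      simpa using (hlim.tendsto_at ⟨x, hx⟩).enorm
  simpa [h1Norm] using (hgradlim.add hvalue).ennrpow_const (1 / 2)

lemma tendsto_h1Norm_conj_sub [Countable ι] [l.IsCountablyGenerated] [IsFiniteMeasureOnCompacts m]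
    (hM : IsCompact M) (hac : m ≪ riemannianVolume n N) (hsupp : M ⊆ (m.restrict M).support)
    {ψ : ι → M → ℝ} {φ : M → ℝ} (hψ : ∀ i, ψ i ∈ convexFunctions M) (hφ : φ ∈ convexFunctions M)
    (hlim : Tendsto (fun i ↦ h1Norm n m M (ψ i - φ)) l (𝓝 0)) :
    Tendsto (fun i ↦ h1Norm n m M (conj M (ψ i) - conj M φ)) l (𝓝 0) := by
  have hlip := lipschitzWith_of_mem_convexFunctions hM.isBounded (φ := φ) hφ
  have hlipψ := fun i ↦ lipschitzWith_of_mem_convexFunctions hM.isBounded (hψ i)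
  have hbdd := bddBelow_range_of_mem_convexFunctions hM.isBounded hφ
  have hbddψ := fun i ↦ bddBelow_range_of_mem_convexFunctions hM.isBounded (hψ i)
  have hsub : TendstoUniformly (fun i ↦ ψ i - φ) 0 l :=
    tendstoUniformly_of_tendsto_h1Norm hM hsupp (fun i ↦ (hlipψ i).sub hlip) hlim
  have hunif : TendstoUniformly ψ φ l := by
    simpa [tendstoUniformly_iff, dist_eq_norm] using hsub
  have hconj := fun i ↦ lipschitzWith_conj hM.isBounded (hbddψ i)
  refine tendsto_h1Norm hM hac (fun i ↦ (hconj i).sub (lipschitzWith_conj hM.isBounded hbdd)) ?_ ?_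
  · have hhopf := tendstoUniformly_hopfLax hbddψ hbdd hunif
    rw [Metric.tendstoUniformly_iff] at hhopf ⊢
    refine fun ε hε ↦ (hhopf ε hε).mono fun i hi x ↦ ?_
    rw [Pi.zero_apply, dist_zero_left, Real.norm_eq_abs]
    calc |(conj M (ψ i) - conj M φ) x| = |-hopfLax M (ψ i) x - -hopfLax M φ x| := rfl
      _ = dist (hopfLax M φ x) (hopfLax M (ψ i) x) := by rw [neg_sub_neg, Real.dist_eq]
      _ < ε := hi x
  · filter_upwards [ae_tendsto_grad_conj hM hac hbddψ hbdd hunif, ae_all_iff.2 fun i ↦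
      ae_grad_sub hM hac (hconj i) (lipschitzWith_conj hM.isBounded hbdd)] with x hx hgrad
    simpa only [hgrad] using tendsto_sub_nhds_zero_iff.2 hx

end Convergence

end ConjugationMap

end

open ConjugationMap Filter in
theorem lemma3p5_general {n : ℕ} {N : Type*} [MetricSpace N]
    [ChartedSpace (EuclideanSpace ℝ (Fin n)) N] [IsManifold (𝓡 n) 1 N]
    [RiemannianBundle (fun x : N ↦ TangentSpace (𝓡 n) x)]
    [IsContMDiffRiemannianBundle (𝓡 n) 1 (EuclideanSpace ℝ (Fin n))
      (fun x : N ↦ TangentSpace (𝓡 n) x)]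
    [IsRiemannianManifold (𝓡 n) N]
    [MeasurableSpace N] [BorelSpace N]
    (M : Set N) (hM : IsCompact M)
    (m : Measure N) [IsFiniteMeasureOnCompacts m] (hsupp : M ⊆ (m.restrict M).support)
    (hac : m ≪ riemannianVolume n N) :
    (∀ φ ∈ convexFunctions M, conj M φ ∈ convexFunctions M) ∧
    (∀ φ ∈ convexFunctions M, IsLipschitzH1 n m M φ) ∧
    (∀ φ ∈ convexFunctions M, ∀ ε : ℝ≥0∞, 0 < ε → ∃ δ : ℝ≥0∞, 0 < δ ∧
      ∀ ψ ∈ convexFunctions M, h1Norm n m M (ψ - φ) < δ →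
        h1Norm n m M (conj M ψ - conj M φ) < ε) := by
  refine ⟨fun φ hφ ↦ conj_mem_convexFunctions (bddBelow_range_of_mem_convexFunctions
      hM.isBounded hφ), fun φ hφ ↦ isLipschitzH1_of_lipschitzWith hM hac
      (lipschitzWith_of_mem_convexFunctions hM.isBounded hφ), fun φ hφ ε hε ↦ ?_⟩
  have hcont : Tendsto (fun ψ : convexFunctions M ↦ h1Norm n m M (conj M ψ - conj M φ))
      (comap (fun ψ : convexFunctions M ↦ h1Norm n m M (ψ - φ)) (nhds 0)) (nhds 0) :=
    tendsto_of_seq_tendsto fun ψ hψ ↦ tendsto_h1Norm_conj_sub hM hac hsupp (fun i ↦ (ψ i).2) hφ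
      (tendsto_comap_iff.1 hψ)
  obtain ⟨δ, hδ, hlt⟩ := (ENNReal.nhds_zero_basis.comap _).eventually_iff.1
    (hcont.eventually_lt_const hε)
  exact ⟨δ, hδ, fun ψ hψ hψφ ↦ hlt (x := ⟨ψ, hψ⟩) hψφ⟩

open ConjugationMap in
theorem lemma3p5 {n : ℕ} {N : Type*} [MetricSpace N] [CompleteSpace N]
    [SecondCountableTopology N]
    [ChartedSpace (EuclideanSpace ℝ (Fin n)) N] [IsManifold (𝓡 n) ∞ N]
    [RiemannianBundle (fun x : N ↦ TangentSpace (𝓡 n) x)]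
    [IsContMDiffRiemannianBundle (𝓡 n) ∞ (EuclideanSpace ℝ (Fin n))
      (fun x : N ↦ TangentSpace (𝓡 n) x)]
    [IsRiemannianManifold (𝓡 n) N]
    [MeasurableSpace N] [BorelSpace N]
    (M : Set N) (hM : IsCompact M)
    (m : Measure N) [IsProbabilityMeasure m] (hsupp : m.support = M)
    (hac : m ≪ riemannianVolume n N) :
    (∀ φ ∈ convexFunctions M, conj M φ ∈ convexFunctions M) ∧
    (∀ φ ∈ convexFunctions M, IsLipschitzH1 n m M φ) ∧
    (∀ φ ∈ convexFunctions M, ∀ ε : ℝ≥0∞, 0 < ε → ∃ δ : ℝ≥0∞, 0 < δ ∧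
      ∀ ψ ∈ convexFunctions M, h1Norm n m M (ψ - φ) < δ →
        h1Norm n m M (conj M ψ - conj M φ) < ε) := by
  have hC1 : IsContMDiffRiemannianBundle (𝓡 n) 1 (EuclideanSpace ℝ (Fin n))
      (fun x : N ↦ TangentSpace (𝓡 n) x) :=
    IsContMDiffRiemannianBundle.of_le (n := ∞) (by exact_mod_cast le_top)
  have hrestrict : m.restrict M = m :=
    Measure.restrict_eq_self_of_ae_mem (hsupp ▸ Measure.support_mem_ae : M ∈ ae m)
  exact lemma3p5_general M hM m (by rw [hrestrict, hsupp]) hac
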